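/- For $a>1$ put $F(u)=a-\log a+\log u$ $(u\ge a)$, let $F^k$ be the $k$-fold iterate of $F$, and put, for $u\ge a$ and $r\ge 1$, $$\tilde F(u)=a\prod_{k=0}^{\infty}\frac{F^k(u)}{a},\quad \phi(u)=a+\int_a^u\frac{dt}{\tilde F(t)},\quad A^1_k(r)=F^k(\phi(ar)),\quad B^0(r)=\frac{\tilde F(ar)}{ar}.$$ For $k\in\mathbb N\cup\{0\}$ and $\eta>0$ let $w(t)=w^{sl}_{k,1}(t;\eta)=t\,B^0(\eta/t)\prod_{j=0}^{k}A^1_j(\eta/t)$ for $0<t\le\eta$ and $w(t)=\eta\,a^{k+1}$ for $t\ge\eta$. Let $n\in\mathbb N=\{1,2,\dots\}$, $B_\eta=\{x\in\mathbb R^n:|x|<\eta\}$, $1<p<\infty$ and $1/p'=1-1/p$. Proposition 5.1. Let $k\in\mathbb N\cup\{0\}$, $\eta>0$, $1<p<\infty$ and $a>1$. There is a constant $C>0$, depending only on $k,p,\eta,a$ (not on $n$), such that for every $n\in\mathbb N$ and every real-valued $u\in C_c^\infty(B_\eta)$ all the integrals below are finite and $$\int_{B_\eta}|\nabla u|^p\,w(|x|)^{p-1}|x|^{1-n}\,dx\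 \ge\ \Big(\frac1{p'}\Big)^{p}\int_{B_\eta}\frac{|u|^p|x|^{1-n}\,dx}{w(|x|)\,A^1_{k+1}(\eta/|x|)^{p}}+C\int_{B_\eta}\frac{|u|^p|x|^{1-n}\,dx}{w(|x|)\,A^1_{k+1}(\eta/|x|)^{p}\big(a-\log a+\log A^1_{k+1}(\eta/|x|)\big)^{2}}.$$ The coefficient $(1/p')^p$ is sharp: for every $n\in\mathbb N$ and every $K>(1/p')^p$ there is $u\in C_c^\infty(B_\eta)$ with $$\int_{B_\eta}|\nabla u|^p\,w(|x|)^{p-1}|x|^{1-n}\,dx\ <\ K\int_{B_\eta}\frac{|u|^p|x|^{1-n}\,dx}{w(|x|)\,A^1_{k+1}(\eta/|x|)^{p}}.$$ -/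

import Mathlib

open MeasureTheory
open scoped ContDiff

noncomputable section

namespace SuperLog

/-- The map `F(u) = a - log a + log u`, used for `u ≥ a`. It is an increasing bijection of
`[a, ∞)` onto itself which fixes `a`. -/
def F (a u : ℝ) : ℝ := a - Real.log a + Real.log u

/-- `Ftilde(u) = a * ∏_{k ≥ 0} F^k(u) / a`, where `F^k` is the `k`-fold iterate of `F`
(for `a > 1` and `u ≥ a`). -/
def Ftilde (a u : ℝ) : ℝ := a * ∏' k : ℕ, ((F a)^[k] u / a)

/-- The infinite product that defines `Ftilde` converges for `a > 1` and `u ≥ a`. -/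
theorem multipliable_Ftilde {a u : ℝ} (ha : 1 < a) (hu : a ≤ u) :
    Multipliable fun k : ℕ => (F a)^[k] u / a := by
  have ha0 : 0 < a := by linarith
  have step : ∀ v, a ≤ v → a ≤ F a v ∧ F a v - a ≤ (v - a) / a := by
    intro v hv
    have hv0 : 0 < v := by linarith
    have h1 := Real.log_le_log ha0 hv
    have h2 := Real.log_le_sub_one_of_pos (div_pos hv0 ha0)
    rw [Real.log_div hv0.ne' ha0.ne'] at h2
    have h3 : (v - a) / a = v / a - 1 := by field_simp
    unfold F
    constructor <;> linarith
  have iter : ∀ k : ℕ, a ≤ (F a)^[k] u ∧ (F a)^[k] u - a ≤ (u - a) * a⁻¹ ^ k := by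
    intro k
    induction k with
    | zero => simpa using hu
    | succ k ih =>
      rw [Function.iterate_succ_apply']
      obtain ⟨h1, h2⟩ := step _ ih.1
      refine ⟨h1, h2.trans ?_⟩
      rw [pow_succ, ← mul_assoc, div_eq_mul_inv]
      exact mul_le_mul_of_nonneg_right ih.2 (by positivity)
  have hs : Summable fun k : ℕ => ((F a)^[k] u / a - 1) := by
    refine Summable.of_nonneg_of_le (f := fun k : ℕ => (u - a) / a * a⁻¹ ^ k) ?_ ?_ ?_
    · intro k
      have := (one_le_div ha0).2 (iter k).1
      linarith
    · intro k
      have h3 : (F a)^[k] u / a - 1 = ((F a)^[k] u - a) / a := by field_simp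
      rw [h3, div_mul_eq_mul_div]
      exact div_le_div_of_nonneg_right (iter k).2 ha0.le
    · exact (summable_geometric_of_lt_one (by positivity) (inv_lt_one_of_one_lt₀ ha)).mul_left _
  have := Real.multipliable_one_add_of_summable hs
  simpa using this

/-- `φ(u) = a + ∫_a^u dt / Ftilde(t)` (for `u ≥ a`), so that `φ(a r) - a` is the
super-logarithm of `r ≥ 1`. -/
def phi (a u : ℝ) : ℝ := a + ∫ t in a..u, 1 / Ftilde a t

/-- `A¹_k(r) = F^k(φ(a r))` for `r ≥ 1` and `k ≥ 0`. -/
def A1 (a : ℝ) (k : ℕ) (r : ℝ) : ℝ := (F a)^[k] (phi a (a * r))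

/-- `B⁰(r) = Ftilde(a r) / (a r)` for `r ≥ 1`. -/
def B0 (a r : ℝ) : ℝ := Ftilde a (a * r) / (a * r)

/-- The super-logarithmic weight `w^{sl}_{k,α}(t; η)` on `(0, ∞)`. -/
def weight (a : ℝ) (k : ℕ) (α η t : ℝ) : ℝ :=
  if t ≤ η then
    t * B0 a (η / t) * (∏ j ∈ Finset.range k, A1 a j (η / t)) * A1 a k (η / t) ^ α
  else
    η * B0 a 1 * (∏ j ∈ Finset.range k, A1 a j 1) * A1 a k 1 ^ α

/-- `u ∈ C_c^∞(B_η)`, where `B_η` is the open ball of radius `η` about `0` in `ℝⁿ`. -/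
structure IsTestFunction {n : ℕ} (η : ℝ) (u : EuclideanSpace ℝ (Fin n) → ℝ) : Prop where
  smooth : ContDiff ℝ ∞ u
  compact : HasCompactSupport u
  supported : tsupport u ⊆ Metric.ball 0 η

/-- The integrand `|∇u(x)|^p w(|x|)^{p-1} |x|^{1-n}`, with `w = w^{sl}_{k,1}(·; η)`. -/
def energyDensity {n : ℕ} (a : ℝ) (k : ℕ) (η p : ℝ)
    (u : EuclideanSpace ℝ (Fin n) → ℝ) (x : EuclideanSpace ℝ (Fin n)) : ℝ :=
  ‖gradient u x‖ ^ p * weight a k 1 η ‖x‖ ^ (p - 1) * ‖x‖ ^ (1 - (n : ℝ))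

/-- The integrand `|u(x)|^p |x|^{1-n} / (w(|x|) A¹_{k+1}(η/|x|)^p)`,
with `w = w^{sl}_{k,1}(·; η)`. -/
def hardyDensity {n : ℕ} (a : ℝ) (k : ℕ) (η p : ℝ)
    (u : EuclideanSpace ℝ (Fin n) → ℝ) (x : EuclideanSpace ℝ (Fin n)) : ℝ :=
  |u x| ^ p * ‖x‖ ^ (1 - (n : ℝ)) / (weight a k 1 η ‖x‖ * A1 a (k + 1) (η / ‖x‖) ^ p)

/-- The integrand
`|u(x)|^p |x|^{1-n} / (w(|x|) A¹_{k+1}(η/|x|)^p (a - log a + log A¹_{k+1}(η/|x|))^2)`,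
with `w = w^{sl}_{k,1}(·; η)`. -/
def remainderDensity {n : ℕ} (a : ℝ) (k : ℕ) (η p : ℝ)
    (u : EuclideanSpace ℝ (Fin n) → ℝ) (x : EuclideanSpace ℝ (Fin n)) : ℝ :=
  |u x| ^ p * ‖x‖ ^ (1 - (n : ℝ)) /
    (weight a k 1 η ‖x‖ * A1 a (k + 1) (η / ‖x‖) ^ p *
      (a - Real.log a + Real.log (A1 a (k + 1) (η / ‖x‖))) ^ 2)

end SuperLog

end

/-!
The function `G(t) = A1_{k+1}(η/t)` is a primitive of `-1/w` on `(0, η)` (`hasDerivAt_A1`): the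
derivative of `F^{k+1}` is the reciprocal of the product of the iterates `F^0, …, F^k`, and
`phi(aη/t)` has the derivative `-1 / (t B0(η/t))`. Moreover `G` decreases from `∞` at `0` to `a` at
`η`; it is unbounded because of the Abel equation `phi (F u) - a = (phi u - a) / a` (`phi_F_sub`).
In polar coordinates the factor `|x|^(1-n)` cancels the Jacobian, so with `g = G(|x|)` the claim
becomes, along every ray, the classical Hardy inequality for `∫_a^∞ |dv/dg|^p dg` and
`∫_a^∞ |v|^p / g^p dg`, with a logarithmic remainder. In particular, the constants do not depend on
the dimension.

The inequality on a ray (`ray_hardy`) is proved without the substitution. Young's inequality with a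
vector field `Y` bounds the energy density from below by the derivative of `-|f|^p Y` plus a
zeroth-order term. For `Y = (1/q)^(p-1) * (1 + c / F(G)) * G^(1-p)`, where `q` is the exponent
conjugate to `p`, the zeroth-order term dominates the two Hardy terms (`hardyField_riccati`): the
correction `c / F(G)` gains a multiple of `c / F(G)^2` and loses only a multiple of `c^2 / F(G)^2`
(`multiplier_ineq`). The boundary terms vanish. Finiteness of the integrals follows from the
boundedness of `w` (`exists_weight_le`) and from the fact that `1 / (w G^p)` has the primitive
`G^(1-p) / (p-1)`.

For the sharpness, take `G^(1/q) * χ(δ log G)` with a bump function `χ`. In the variable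
`s = δ log G` (`setIntegral_comp_log_A1`) its energy and its Hardy integral are `1/δ` times the
integrals of `|χ/q + δ χ'|^p` and `|χ|^p`, so that their quotient tends to `(1/q)^p` as `δ → 0`
(`exists_C1_almost_extremal`). As `G` is only treated as a `C¹` function, these functions are
mollified (`exists_contDiff_approx`) before they are composed with the norm.
-/

namespace SuperLog

open Set Filter Topology

/-! ### The map `F`, the product `Ftilde` and the super-logarithm `phi` -/

lemma F_eq {a u : ℝ} (ha : 1 < a) (hu : 0 < u) : F a u = a + Real.log (u / a) := by
  rw [F, Real.log_div hu.ne' (by linarith)]; ring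

lemma F_self (a : ℝ) : F a a = a := by simp [F]

lemma le_F {a u : ℝ} (ha : 1 < a) (hu : a ≤ u) : a ≤ F a u := by
  rw [F_eq ha (by linarith)]
  have := Real.log_nonneg ((one_le_div (by linarith : (0 : ℝ) < a)).2 hu)
  linarith

/-- `F` contracts the distance to its fixed point `a` by the factor `1 / a`. -/
lemma F_sub_le {a u : ℝ} (ha : 1 < a) (hu : a ≤ u) : F a u - a ≤ (u - a) * a⁻¹ := by
  have ha0 : 0 < a := by linarith
  rw [F_eq ha (by linarith)]
  have h := Real.log_le_sub_one_of_pos (div_pos (by linarith : 0 < u) ha0)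
  have h3 : (u - a) * a⁻¹ = u / a - 1 := by field_simp
  linarith

lemma hasDerivAt_F {a u : ℝ} (hu : 0 < u) : HasDerivAt (F a) u⁻¹ u :=
  (Real.hasDerivAt_log hu.ne').const_add (a - Real.log a)

lemma tendsto_F_atTop (a : ℝ) : Tendsto (F a) atTop atTop :=
  tendsto_atTop_add_const_left _ _ Real.tendsto_log_atTop

lemma le_iterate_F {a u : ℝ} (ha : 1 < a) (hu : a ≤ u) (k : ℕ) : a ≤ (F a)^[k] u := by
  induction k with
  | zero => simpa using hu
  | succ k ih => rw [Function.iterate_succ_apply']; exact le_F ha ih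

lemma iterate_F_sub_le {a u : ℝ} (ha : 1 < a) (hu : a ≤ u) (k : ℕ) :
    (F a)^[k] u - a ≤ (u - a) * a⁻¹ ^ k := by
  have ha0 : 0 < a := by linarith
  induction k with
  | zero => simp
  | succ k ih =>
    rw [Function.iterate_succ_apply', pow_succ, ← mul_assoc]
    exact (F_sub_le ha (le_iterate_F ha hu k)).trans
      (mul_le_mul_of_nonneg_right ih (by positivity))

lemma iterate_F_le {a u : ℝ} (ha : 1 < a) (hu : a ≤ u) (k : ℕ) : (F a)^[k] u ≤ u := by
  have h := iterate_F_sub_le ha hu k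
  have h1 : a⁻¹ ^ k ≤ 1 := pow_le_one₀ (by positivity) (inv_le_one_of_one_le₀ ha.le)
  nlinarith [mul_le_mul_of_nonneg_left h1 (sub_nonneg.2 hu)]

lemma iterate_F_self (a : ℝ) (k : ℕ) : (F a)^[k] a = a :=
  Function.iterate_fixed (F_self a) k

/-- The chain rule along the orbit of `u`: `(F^k)'(u) = ∏_{j < k} 1 / F^j(u)`. -/
lemma hasDerivAt_iterate_F {a u : ℝ} (ha : 1 < a) (hu : a ≤ u) (k : ℕ) :
    HasDerivAt ((F a)^[k]) (∏ j ∈ Finset.range k, (F a)^[j] u)⁻¹ u := by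
  induction k with
  | zero => simpa using hasDerivAt_id u
  | succ k ih =>
    rw [Finset.prod_range_succ, mul_inv, mul_comm, Function.iterate_succ']
    exact (hasDerivAt_F (by linarith [le_iterate_F ha hu k])).comp u ih

lemma summable_iterate_F_sub {a u : ℝ} (ha : 1 < a) (hu : a ≤ u) :
    Summable fun k : ℕ => (F a)^[k] u - a :=
  Summable.of_nonneg_of_le (fun k => sub_nonneg.2 (le_iterate_F ha hu k))
    (iterate_F_sub_le ha hu)
    ((summable_geometric_of_lt_one (by positivity) (inv_lt_one_of_one_lt₀ ha)).mul_left _)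

lemma log_iterate_F_div {a u : ℝ} (ha : 1 < a) (hu : a ≤ u) (k : ℕ) :
    Real.log ((F a)^[k] u / a) = (F a)^[k] (F a u) - a := by
  rw [← Function.iterate_succ_apply, Function.iterate_succ_apply',
    F_eq ha (by linarith [le_iterate_F ha hu k])]
  ring

/-- Since `log (F^k(u) / a) = F^{k+1}(u) - a`, the infinite product is the exponential of the
series of the distances of the iterates from the fixed point. -/
lemma Ftilde_eq_exp {a u : ℝ} (ha : 1 < a) (hu : a ≤ u) :
    Ftilde a u = a * Real.exp (∑' k : ℕ, ((F a)^[k] (F a u) - a)) := by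
  have ha0 : 0 < a := by linarith
  have h := Real.rexp_tsum_eq_tprod (f := fun k : ℕ => (F a)^[k] u / a)
    (fun k => div_pos (by linarith [le_iterate_F ha hu k]) ha0)
    (by
      simp only [log_iterate_F_div ha hu]
      exact summable_iterate_F_sub ha (le_F ha hu))
  rw [Ftilde, ← h]
  simp only [log_iterate_F_div ha hu]

lemma Ftilde_pos {a u : ℝ} (ha : 1 < a) (hu : a ≤ u) : 0 < Ftilde a u := by
  rw [Ftilde_eq_exp ha hu]; positivity

lemma Ftilde_eq_mul {a u : ℝ} (ha : 1 < a) (hu : a ≤ u) :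
    Ftilde a u = u / a * Ftilde a (F a u) := by
  have ha0 : 0 < a := by linarith
  have hu0 : 0 < u := by linarith
  rw [Ftilde_eq_exp ha hu, Ftilde_eq_exp ha (le_F ha hu),
    (summable_iterate_F_sub ha (le_F ha hu)).tsum_eq_zero_add, Real.exp_add]
  simp only [Function.iterate_zero, id, Function.iterate_succ_apply]
  rw [F_eq ha hu0, add_sub_cancel_left, Real.exp_log (by positivity)]
  ring

lemma a_le_Ftilde {a u : ℝ} (ha : 1 < a) (hu : a ≤ u) : a ≤ Ftilde a u := by
  rw [Ftilde_eq_exp ha hu]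
  have : 1 ≤ Real.exp (∑' k : ℕ, ((F a)^[k] (F a u) - a)) :=
    Real.one_le_exp (tsum_nonneg fun k => sub_nonneg.2 (le_iterate_F ha (le_F ha hu) k))
  nlinarith

lemma le_Ftilde {a u : ℝ} (ha : 1 < a) (hu : a ≤ u) : u ≤ Ftilde a u := by
  have ha0 : 0 < a := by linarith
  rw [Ftilde_eq_mul ha hu]
  calc u = u / a * a := by field_simp
    _ ≤ _ := mul_le_mul_of_nonneg_left (a_le_Ftilde ha (le_F ha hu))
      (div_nonneg (by linarith) ha0.le)

/-- The geometric decay of the distances `F^k(u) - a` shows that `Ftilde` grows at most like a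
power. -/
lemma Ftilde_le {a u : ℝ} (ha : 1 < a) (hu : a ≤ u) :
    Ftilde a u ≤ a * Real.exp (Real.log (u / a) * (1 - a⁻¹)⁻¹) := by
  have ha0 : 0 < a := by linarith
  have hgeo := hasSum_geometric_of_lt_one (by positivity) (inv_lt_one_of_one_lt₀ ha)
  rw [Ftilde_eq_exp ha hu]
  have h2 : F a u - a = Real.log (u / a) := by rw [F_eq ha (by linarith)]; ring
  rw [← h2, ← hgeo.tsum_eq, ← tsum_mul_left]
  refine mul_le_mul_of_nonneg_left (Real.exp_le_exp.2 ?_) ha0.le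
  exact (summable_iterate_F_sub ha (le_F ha hu)).tsum_le_tsum
    (iterate_F_sub_le ha (le_F ha hu)) (hgeo.summable.mul_left _)

lemma continuousOn_Ftilde {a : ℝ} (ha : 1 < a) : ContinuousOn (Ftilde a) (Ici a) := by
  have ha0 : 0 < a := by linarith
  have key : ∀ M, ContinuousOn (Ftilde a) (Icc a M) := by
    intro M
    have hF : ContinuousOn (F a) (Icc a M) := fun u hu =>
      (hasDerivAt_F (by linarith [hu.1])).continuousAt.continuousWithinAt
    have h1 : ContinuousOn (fun u => ∑' k : ℕ, ((F a)^[k] (F a u) - a)) (Icc a M) := by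
      refine continuousOn_tsum (u := fun k => (M - a) * a⁻¹ ^ k) (fun k => ?_)
        ((summable_geometric_of_lt_one (by positivity) (inv_lt_one_of_one_lt₀ ha)).mul_left _)
        (fun k u hu => ?_)
      · refine ContinuousOn.sub (fun u hu => ?_) continuousOn_const
        exact (ContinuousAt.comp (g := (F a)^[k]) (hasDerivAt_iterate_F ha
          (le_F ha hu.1) k).continuousAt
          (hasDerivAt_F (by linarith [hu.1])).continuousAt).continuousWithinAt
      · have h := le_iterate_F ha (le_F ha hu.1) k
        rw [Real.norm_of_nonneg (sub_nonneg.2 h)]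
        refine (iterate_F_sub_le ha (le_F ha hu.1) k).trans
          (mul_le_mul_of_nonneg_right ?_ (by positivity))
        have := iterate_F_le ha hu.1 1
        simp only [Function.iterate_one] at this
        linarith [hu.2]
    exact (continuousOn_const.mul h1.rexp).congr fun u hu => Ftilde_eq_exp ha hu.1
  intro u hu
  exact ((key (u + 1)) u ⟨hu, by linarith⟩).mono_of_mem_nhdsWithin
    (mem_nhdsWithin.2 ⟨Iio (u + 1), isOpen_Iio, by simp, fun x hx => ⟨hx.2, le_of_lt hx.1⟩⟩)

lemma continuousOn_one_div_Ftilde {a : ℝ} (ha : 1 < a) :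
    ContinuousOn (fun t => 1 / Ftilde a t) (Ici a) :=
  continuousOn_const.div (continuousOn_Ftilde ha) fun _ ht => (Ftilde_pos ha ht).ne'

lemma intervalIntegrable_one_div_Ftilde {a u v : ℝ} (ha : 1 < a) (hu : a ≤ u) (hv : a ≤ v) :
    IntervalIntegrable (fun t => 1 / Ftilde a t) volume u v :=
  ((continuousOn_one_div_Ftilde ha).mono fun _ ht => (le_inf hu hv).trans ht.1).intervalIntegrable

lemma phi_self (a : ℝ) : phi a a = a := by simp [phi]

lemma hasDerivAt_phi {a u : ℝ} (ha : 1 < a) (hu : a < u) :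
    HasDerivAt (phi a) (1 / Ftilde a u) u := by
  have hc := continuousOn_one_div_Ftilde ha
  exact (intervalIntegral.integral_hasDerivAt_right
    (intervalIntegrable_one_div_Ftilde ha le_rfl hu.le)
    ((hc.mono Ioi_subset_Ici_self).stronglyMeasurableAtFilter isOpen_Ioi u hu)
    (hc.continuousAt (Ici_mem_nhds hu))).const_add a

lemma monotoneOn_phi {a : ℝ} (ha : 1 < a) : MonotoneOn (phi a) (Ici a) := by
  intro u hu v hv huv
  have h := intervalIntegral.integral_add_adjacent_intervals
    (intervalIntegrable_one_div_Ftilde ha le_rfl hu) (intervalIntegrable_one_div_Ftilde ha hu hv)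
  have h2 : 0 ≤ ∫ t in u..v, 1 / Ftilde a t :=
    intervalIntegral.integral_nonneg huv fun t ht =>
      (one_div_pos.2 (Ftilde_pos ha (le_trans hu ht.1))).le
  simp only [phi]
  linarith

lemma le_phi {a u : ℝ} (ha : 1 < a) (hu : a ≤ u) : a ≤ phi a u := by
  simpa [phi_self] using monotoneOn_phi ha self_mem_Ici hu hu

lemma phi_le {a u : ℝ} (ha : 1 < a) (hu : a ≤ u) : phi a u ≤ F a u := by
  have ha0 : 0 < a := by linarith
  have h : ∫ t in a..u, 1 / Ftilde a t ≤ ∫ t in a..u, 1 / t := by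
    refine intervalIntegral.integral_mono_on hu (intervalIntegrable_one_div_Ftilde ha le_rfl hu)
      ?_ fun t ht => one_div_le_one_div_of_le (by linarith [ht.1]) (le_Ftilde ha ht.1)
    refine intervalIntegral.intervalIntegrable_one_div (fun t ht => ?_) continuousOn_id
    have : a ≤ t := (le_inf le_rfl hu).trans ht.1
    exact (by linarith : (0 : ℝ) < t).ne'
  rw [integral_one_div_of_pos ha0 (by linarith)] at h
  rw [phi, F_eq ha (by linarith)]
  linarith

lemma continuousWithinAt_phi_self {a : ℝ} (ha : 1 < a) : ContinuousWithinAt (phi a) (Ici a) a := by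
  have h1 : Tendsto (F a) (𝓝[≥] a) (𝓝 a) := by
    have := (hasDerivAt_F (a := a) (by linarith : 0 < a)).continuousAt.continuousWithinAt
      (s := Ici a)
    rwa [ContinuousWithinAt, F_self] at this
  rw [ContinuousWithinAt, phi_self]
  exact tendsto_of_tendsto_of_tendsto_of_le_of_le' tendsto_const_nhds h1
    (eventually_mem_nhdsWithin.mono fun u hu => le_phi ha hu)
    (eventually_mem_nhdsWithin.mono fun u hu => phi_le ha hu)

/-- The Abel equation of the super-logarithm: one application of `F` divides `phi - a` by `a`. -/
lemma phi_F_sub {a u : ℝ} (ha : 1 < a) (hu : a ≤ u) : phi a (F a u) - a = (phi a u - a) / a := by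
  have ha0 : 0 < a := by linarith
  have hI : uIcc a u = Icc a u := uIcc_of_le hu
  have h := intervalIntegral.integral_comp_mul_deriv' (f := F a) (f' := fun t => t⁻¹)
    (g := fun t => 1 / Ftilde a t) (a := a) (b := u)
    (fun t ht => hasDerivAt_F (by rw [hI] at ht; linarith [ht.1]))
    (by
      rw [hI]
      exact continuousOn_id.inv₀ fun t ht => (by linarith [ht.1] : (0 : ℝ) < t).ne')
    ((continuousOn_one_div_Ftilde ha).mono (by
      rw [hI]; rintro _ ⟨t, ht, rfl⟩; exact le_F ha ht.1))
  rw [F_self] at h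
  simp only [phi, add_sub_cancel_left, ← h, ← intervalIntegral.integral_div]
  refine intervalIntegral.integral_congr fun t ht => ?_
  rw [hI] at ht
  have ht0 : 0 < t := by linarith [ht.1]
  have := Ftilde_pos ha (le_F ha ht.1)
  simp only [Function.comp, Ftilde_eq_mul ha ht.1]
  field_simp

lemma lt_phi {a u : ℝ} (ha : 1 < a) (hu : a < u) : a < phi a u := by
  have : 0 < ∫ t in a..u, 1 / Ftilde a t :=
    intervalIntegral.intervalIntegral_pos_of_pos_on
      (intervalIntegrable_one_div_Ftilde ha le_rfl hu.le)
      (fun t ht => one_div_pos.2 (Ftilde_pos ha ht.1.le)) hu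
  simp only [phi]; linarith

/-- `phi - a` is multiplied by `a` along the backward orbit `u ↦ a * exp (u - a)` of `F`, so `phi`
is unbounded. -/
lemma tendsto_phi_atTop {a : ℝ} (ha : 1 < a) : Tendsto (phi a) atTop atTop := by
  have ha0 : 0 < a := by linarith
  have horbit : ∀ m : ℕ, ∃ u, a ≤ u ∧ phi a u - a = a ^ m * (phi a (a + 1) - a) := by
    intro m
    induction m with
    | zero => exact ⟨a + 1, by linarith, by simp⟩
    | succ m ih =>
      obtain ⟨u, hu, h⟩ := ih
      have hF : F a (a * Real.exp (u - a)) = u := by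
        rw [F_eq ha (by positivity), mul_div_cancel_left₀ _ ha0.ne', Real.log_exp]; ring
      have hle : a ≤ a * Real.exp (u - a) :=
        le_mul_of_one_le_right ha0.le (Real.one_le_exp (sub_nonneg.2 hu))
      refine ⟨_, hle, ?_⟩
      have h2 := phi_F_sub ha hle
      rw [hF, h, eq_div_iff ha0.ne'] at h2
      rw [← h2]; ring
  refine tendsto_atTop.2 fun M => ?_
  have hd : 0 < phi a (a + 1) - a := sub_pos.2 (lt_phi ha (by linarith))
  obtain ⟨m, hm⟩ := pow_unbounded_of_one_lt ((M - a) / (phi a (a + 1) - a)) ha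
  obtain ⟨u, hu, h⟩ := horbit m
  rw [div_lt_iff₀ hd] at hm
  filter_upwards [eventually_ge_atTop u] with v hv
  have := monotoneOn_phi ha hu (hu.trans hv : a ≤ v) hv
  linarith

/-! ### The functions `A1` and the weight as functions of the radius -/

section Radius

variable {a η : ℝ}

lemma a_lt_radius (ha : 1 < a) {t : ℝ} (h0 : 0 < t) (h1 : t < η) : a < a * (η / t) :=
  lt_mul_of_one_lt_right (by linarith) ((one_lt_div h0).2 h1)

lemma le_A1 (ha : 1 < a) (k : ℕ) {t : ℝ} (h0 : 0 < t) (h1 : t < η) : a ≤ A1 a k (η / t) :=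
  le_iterate_F ha (le_phi ha (a_lt_radius ha h0 h1).le) k

/-- For `α = 1` the weight is `t * B0(η/t) * ∏_{j ≤ k} A1_j(η/t)`. -/
lemma weight_eq (k : ℕ) {t : ℝ} (h1 : t ≤ η) :
    weight a k 1 η t = t * B0 a (η / t) * ∏ j ∈ Finset.range (k + 1), A1 a j (η / t) := by
  rw [weight, if_pos h1, Real.rpow_one, Finset.prod_range_succ, mul_assoc]

lemma prod_A1_pos (ha : 1 < a) (k : ℕ) {t : ℝ} (h0 : 0 < t) (h1 : t < η) :
    0 < ∏ j ∈ Finset.range k, A1 a j (η / t) :=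
  Finset.prod_pos fun j _ => by linarith [le_A1 ha j h0 h1]

lemma weight_pos (ha : 1 < a) (k : ℕ) {t : ℝ} (h0 : 0 < t) (h1 : t < η) :
    0 < weight a k 1 η t := by
  have h := a_lt_radius ha h0 h1
  rw [weight_eq k h1.le]
  exact mul_pos (mul_pos h0 (div_pos (Ftilde_pos ha h.le) (by linarith))) (prod_A1_pos ha _ h0 h1)

/-- The weight is the one for which the super-logarithmic function `A1_{k+1}(η/t)` is a primitive
of `-1/w`. -/
lemma hasDerivAt_A1 (ha : 1 < a) (k : ℕ) {t : ℝ} (h0 : 0 < t) (h1 : t < η) :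
    HasDerivAt (fun t => A1 a (k + 1) (η / t)) (-(1 / weight a k 1 η t)) t := by
  have h := a_lt_radius ha h0 h1
  have hη : 0 < η := h0.trans h1
  have hr : HasDerivAt (fun t => a * (η / t)) (a * (-(η / t ^ 2))) t := by
    have := ((hasDerivAt_inv h0.ne').const_mul η).const_mul a
    simpa [div_eq_mul_inv] using this
  have hc := (hasDerivAt_iterate_F ha (le_phi ha h.le) (k + 1)).comp t
    ((hasDerivAt_phi ha h).comp t hr)
  refine hc.congr_deriv ?_
  rw [weight_eq k h1.le, B0]
  have := prod_A1_pos ha (k + 1) h0 h1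
  have := Ftilde_pos ha h.le
  simp only [A1] at *
  field_simp

lemma continuousOn_A1 (ha : 1 < a) (k : ℕ) :
    ContinuousOn (fun t => A1 a k (η / t)) (Ioo 0 η) := by
  intro t ht
  have h := a_lt_radius ha ht.1 ht.2
  have h0 := ht.1.ne'
  have hr : ContinuousAt (fun t : ℝ => a * (η / t)) t := by fun_prop (disch := assumption)
  have hφ : ContinuousAt (fun t : ℝ => phi a (a * (η / t))) t :=
    ContinuousAt.comp (f := fun t : ℝ => a * (η / t)) (hasDerivAt_phi ha h).continuousAt hr
  exact (ContinuousAt.comp (f := fun t : ℝ => phi a (a * (η / t)))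
    (hasDerivAt_iterate_F ha (le_phi ha h.le) k).continuousAt hφ).continuousWithinAt

lemma continuousOn_weight (ha : 1 < a) (k : ℕ) :
    ContinuousOn (weight a k 1 η) (Ioo 0 η) := by
  have hr : ContinuousOn (fun t : ℝ => a * (η / t)) (Ioo 0 η) := fun t ht => by
    have h0 := ht.1.ne'
    exact ContinuousAt.continuousWithinAt (by fun_prop (disch := assumption))
  have hmaps : ∀ t ∈ Ioo 0 η, a ≤ a * (η / t) := fun t ht => (a_lt_radius ha ht.1 ht.2).le
  refine ContinuousOn.congr (f := fun t => t * B0 a (η / t) *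
    ∏ j ∈ Finset.range (k + 1), A1 a j (η / t)) ?_ fun t ht => weight_eq k ht.2.le
  refine (continuousOn_id.mul (((continuousOn_Ftilde ha).comp hr hmaps).div hr
    fun t ht => ?_)).mul (continuousOn_finsetProd _ fun j _ => continuousOn_A1 ha j)
  linarith [hmaps t ht]

lemma tendsto_A1_zero (ha : 1 < a) (hη : 0 < η) (k : ℕ) :
    Tendsto (fun t => A1 a k (η / t)) (𝓝[>] 0) atTop := by
  have h1 : Tendsto (fun t : ℝ => a * (η / t)) (𝓝[>] 0) atTop :=
    (tendsto_inv_nhdsGT_zero.const_mul_atTop hη).const_mul_atTop (by linarith)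
  exact ((tendsto_F_atTop a).iterate k).comp ((tendsto_phi_atTop ha).comp h1)

lemma tendsto_A1_radius (ha : 1 < a) (hη : 0 < η) (k : ℕ) :
    Tendsto (fun t => A1 a k (η / t)) (𝓝[<] η) (𝓝 a) := by
  have h1 : Tendsto (fun t : ℝ => a * (η / t)) (𝓝[<] η) (𝓝[≥] a) := by
    refine tendsto_nhdsWithin_iff.2 ⟨?_, ?_⟩
    · have hc : ContinuousAt (fun t : ℝ => a * (η / t)) η := by
        have h0 := hη.ne'
        fun_prop (disch := assumption)
      have := hc.tendsto
      rw [div_self hη.ne', mul_one] at this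
      exact this.mono_left nhdsWithin_le_nhds
    · filter_upwards [Ioo_mem_nhdsLT hη] with t ht
      exact (a_lt_radius ha ht.1 ht.2).le
  have h2 : Tendsto (phi a) (𝓝[≥] a) (𝓝 a) := by
    simpa [ContinuousWithinAt, phi_self] using continuousWithinAt_phi_self ha
  have h3 : Tendsto ((F a)^[k]) (𝓝 a) (𝓝 a) := by
    have := (hasDerivAt_iterate_F ha (le_refl a) k).continuousAt.tendsto
    rwa [iterate_F_self] at this
  exact h3.comp (h2.comp h1)

/-- The weight is bounded: all factors apart from `t` grow at most like powers of `log (η/t)`. -/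
lemma exists_weight_le (ha : 1 < a) (hη : 0 < η) (k : ℕ) :
    ∃ M : ℝ, ∀ t ∈ Ioo 0 η, weight a k 1 η t ≤ M := by
  have ha0 : 0 < a := by linarith
  set q : ℝ := (1 - a⁻¹)⁻¹ with hq
  have hq0 : 0 < q := inv_pos.2 (sub_pos.2 (inv_lt_one_of_one_lt₀ ha))
  -- With `s = log (η/t)` the weight is at most `η * exp (-s) * ((a+s)/a)^q * (a+s)^(k+1)`.
  have hlim : Tendsto (fun v : ℝ => Real.exp (-v) * v ^ (q + (k + 1 : ℕ))) atTop (𝓝 0) := by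
    have := tendsto_rpow_mul_exp_neg_mul_atTop_nhds_zero (q + (k + 1 : ℕ)) 1 one_pos
    simpa [mul_comm] using this
  obtain ⟨N, hN⟩ : ∃ N : ℝ, ∀ v ∈ Ici a, Real.exp (-v) * v ^ (q + (k + 1 : ℕ)) ≤ N := by
    have hc : ContinuousOn (fun v : ℝ => Real.exp (-v) * v ^ (q + (k + 1 : ℕ))) (Ici a) := by
      refine (by fun_prop : Continuous fun v : ℝ => Real.exp (-v)).continuousOn.mul ?_
      exact continuousOn_id.rpow_const fun v hv => Or.inr (by positivity)
    obtain ⟨b, hb⟩ := eventually_atTop.1 (hlim.eventually (Iio_mem_nhds one_pos))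
    obtain ⟨N, hN⟩ := (isCompact_Icc (a := a) (b := max a b)).bddAbove_image
      (hc.mono Icc_subset_Ici_self)
    refine ⟨max N 1, fun v hv => ?_⟩
    rcases le_total v (max a b) with h | h
    · exact (hN ⟨v, ⟨hv, h⟩, rfl⟩).trans (le_max_left _ _)
    · exact (hb v ((le_max_right _ _).trans h)).le.trans (le_max_right _ _)
  refine ⟨η * Real.exp a * N, fun t ht => ?_⟩
  have h := a_lt_radius ha ht.1 ht.2
  set v := F a (a * (η / t)) with hv
  have hva : a ≤ v := le_F ha h.le
  have hv0 : 0 < v := by linarith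
  have ht0 := ht.1
  have ht_eq : t = η * Real.exp a * Real.exp (-v) := by
    rw [hv, F_eq ha (by positivity), mul_div_cancel_left₀ _ ha0.ne', neg_add, Real.exp_add,
      ← Real.log_inv, Real.exp_log (by positivity), Real.exp_neg]
    have := Real.exp_pos a
    field_simp
  have hB : B0 a (η / t) ≤ v ^ q := by
    have h1 : B0 a (η / t) = Ftilde a v / a := by
      rw [B0, Ftilde_eq_mul ha h.le, ← hv]
      have : 0 < η / t := by positivity
      field_simp
    rw [h1, div_le_iff₀' ha0]
    refine (Ftilde_le ha hva).trans (mul_le_mul_of_nonneg_left ?_ ha0.le)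
    rw [← Real.rpow_def_of_pos (by positivity)]
    exact Real.rpow_le_rpow (by positivity) (div_le_self hv0.le ha.le) hq0.le
  have hP : ∏ j ∈ Finset.range (k + 1), A1 a j (η / t) ≤ v ^ (k + 1) := by
    refine (Finset.prod_le_prod (g := fun _ => v) (fun j _ => by
      linarith [le_A1 ha j ht.1 ht.2]) fun j _ => ?_).trans_eq (by simp)
    exact (iterate_F_le ha (le_phi ha h.le) j).trans (phi_le ha h.le)
  rw [weight_eq k ht.2.le]
  calc t * B0 a (η / t) * ∏ j ∈ Finset.range (k + 1), A1 a j (η / t)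
      ≤ t * v ^ q * v ^ (k + 1) := by
        refine mul_le_mul (mul_le_mul_of_nonneg_left hB ht0.le) hP
          (prod_A1_pos ha _ ht.1 ht.2).le (by positivity)
    _ = η * Real.exp a * (Real.exp (-v) * v ^ (q + (k + 1 : ℕ))) := by
        rw [Real.rpow_add_natCast hv0.ne']
        nth_rewrite 1 [ht_eq]
        ring
    _ ≤ _ := mul_le_mul_of_nonneg_left (hN v hva) (by positivity)

end Radius

/-! ### Calculus on an open interval with limits at the endpoints -/

lemma exists_continuousOn_Icc_extension {f : ℝ → ℝ} {α β la lb : ℝ} (hαβ : α < β)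
    (hf : ContinuousOn f (Ioo α β)) (ha : Tendsto f (𝓝[>] α) (𝓝 la))
    (hb : Tendsto f (𝓝[<] β) (𝓝 lb)) :
    ∃ g : ℝ → ℝ, ContinuousOn g (Icc α β) ∧ EqOn g f (Ioo α β) ∧ g α = la ∧ g β = lb :=
  ⟨extendFrom (Ioo α β) f, continuousOn_Icc_extendFrom_Ioo hf ha hb,
    fun x hx => extendFrom_eq (subset_closure hx) (hf x hx),
    eq_lim_at_left_extendFrom_Ioo hαβ ha, eq_lim_at_right_extendFrom_Ioo hαβ hb⟩

/-- The fundamental theorem of calculus as an inequality on an open interval; the derivative itself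
need not be integrable. -/
lemma sub_le_setIntegral_Ioo_of_tendsto {f f' φ : ℝ → ℝ} {α β la lb : ℝ} (hαβ : α < β)
    (hf : ∀ t ∈ Ioo α β, HasDerivAt f (f' t) t) (ha : Tendsto f (𝓝[>] α) (𝓝 la))
    (hb : Tendsto f (𝓝[<] β) (𝓝 lb)) (hφ : IntegrableOn φ (Ioo α β))
    (hle : ∀ t ∈ Ioo α β, f' t ≤ φ t) : lb - la ≤ ∫ t in Ioo α β, φ t := by
  obtain ⟨g, hg, hgf, rfl, rfl⟩ := exists_continuousOn_Icc_extension hαβ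
    (fun t ht => (hf t ht).continuousAt.continuousWithinAt) ha hb
  rw [← integral_Ioc_eq_integral_Ioo, ← intervalIntegral.integral_of_le hαβ.le]
  refine intervalIntegral.sub_le_integral_of_hasDeriv_right_of_le hαβ.le hg (fun t ht => ?_)
    (integrableOn_Icc_iff_integrableOn_Ioo (by simp) (by simp) |>.2 hφ) hle
  exact ((hf t ht).congr_of_eventuallyEq
    (hgf.eventuallyEq_of_mem (isOpen_Ioo.mem_nhds ht))).hasDerivWithinAt

lemma integrableOn_Ioo_deriv_of_nonneg {f f' : ℝ → ℝ} {α β la lb : ℝ} (hαβ : α < β)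
    (hf : ∀ t ∈ Ioo α β, HasDerivAt f (f' t) t) (ha : Tendsto f (𝓝[>] α) (𝓝 la))
    (hb : Tendsto f (𝓝[<] β) (𝓝 lb)) (hpos : ∀ t ∈ Ioo α β, 0 ≤ f' t) :
    IntegrableOn f' (Ioo α β) := by
  obtain ⟨g, hg, hgf, -, -⟩ := exists_continuousOn_Icc_extension hαβ
    (fun t ht => (hf t ht).continuousAt.continuousWithinAt) ha hb
  exact (intervalIntegral.integrableOn_deriv_of_nonneg hg (fun t ht =>
    (hf t ht).congr_of_eventuallyEq (hgf.eventuallyEq_of_mem (isOpen_Ioo.mem_nhds ht)))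
    hpos).mono_set Ioo_subset_Ioc_self

/-! ### Pointwise inequalities -/

lemma one_add_rpow_le {z q : ℝ} (hz : 0 ≤ z) (hq : 0 ≤ q) (hqz : q * z ≤ 1) :
    (1 + z) ^ q ≤ 1 + q * z + (q * z) ^ 2 := by
  have h1 : (1 + z) ^ q ≤ Real.exp (q * z) := by
    rw [mul_comm, Real.exp_mul]
    exact Real.rpow_le_rpow (by linarith) (by linarith [Real.add_one_le_exp z]) hq
  have h2 := (abs_le.1 (Real.abs_exp_sub_one_sub_id_le
    (abs_le.2 ⟨by linarith [mul_nonneg hq hz], hqz⟩))).2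
  linarith

/-- Young's inequality with a weight `W` and a multiplier `Y`. -/
lemma young_weighted {p q : ℝ} (hpq : p.HolderConjugate q) {A B Y W : ℝ} (hA : 0 ≤ A) (hB : 0 ≤ B)
    (hY : 0 ≤ Y) (hW : 0 < W) :
    p * A * B ^ (p - 1) * Y ≤ A ^ p * W ^ (p - 1) + (p - 1) * (B ^ p * Y ^ q / W) := by
  have hp0 := hpq.pos
  have h := Real.young_inequality_of_nonneg (a := A * W ^ ((p - 1) / p))
    (b := B ^ (p - 1) * Y * W ^ (-((p - 1) / p))) (by positivity) (by positivity) hpq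
  have e1 : (p - 1) * q = p := hpq.sub_one_mul_conj
  have e2 : (p - 1) / p * q = 1 := by rw [div_mul_eq_mul_div, e1, div_self hp0.ne']
  have e3 : p / q = p - 1 := hpq.div_conj_eq_sub_one
  rw [Real.mul_rpow hA (by positivity), Real.mul_rpow (by positivity) (by positivity),
    Real.mul_rpow (by positivity) hY, ← Real.rpow_mul hW.le, ← Real.rpow_mul hW.le,
    ← Real.rpow_mul hB, e1, neg_mul, e2, div_mul_cancel₀ _ hp0.ne', Real.rpow_neg_one] at h
  have hl : A * W ^ ((p - 1) / p) * (B ^ (p - 1) * Y * W ^ (-((p - 1) / p))) =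
      A * B ^ (p - 1) * Y := by
    rw [Real.rpow_neg hW.le]
    have := (Real.rpow_pos_of_pos hW ((p - 1) / p)).ne'
    field_simp
  rw [hl] at h
  calc p * A * B ^ (p - 1) * Y = p * (A * B ^ (p - 1) * Y) := by ring
    _ ≤ p * (A ^ p * W ^ (p - 1) / p + B ^ p * Y ^ q * W⁻¹ / q) :=
      mul_le_mul_of_nonneg_left h hp0.le
    _ = A ^ p * W ^ (p - 1) + p / q * (B ^ p * Y ^ q / W) := by
      have := hp0.ne'
      field_simp
    _ = _ := by rw [e3]

/-- The multiplier `(1/q)^(p-1) * (1 + c/L)`, a logarithmic correction of the maximizer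
`(1/q)^(p-1)` of `y ↦ (p-1) * (y - y^q)`: the term that its derivative contributes is of first order
in `c`, the loss of the maximum only of second order. -/
lemma multiplier_ineq {p q : ℝ} (hpq : p.HolderConjugate q) {c L : ℝ} (hc : 0 ≤ c)
    (hqc : q * c ≤ 1) (hL : 1 ≤ L) :
    (1 / q) ^ p + (1 / q) ^ (p - 1) * (c - p * c ^ 2) / L ^ 2 ≤
      (1 / q) ^ (p - 1) * c / L ^ 2 + (p - 1) * ((1 / q) ^ (p - 1) * (1 + c / L)) -
        (p - 1) * ((1 / q) ^ (p - 1) * (1 + c / L)) ^ q := by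
  have hp0 := hpq.pos
  have hq0 := hpq.symm.pos
  have hp1 := hpq.sub_one_pos
  set m := (1 / q) ^ (p - 1) with hm
  have hm0 : 0 < m := by positivity
  have hl0 : (0 : ℝ) < 1 / q := by positivity
  have hz0 : 0 ≤ c / L := by positivity
  have hz : q * (c / L) ≤ 1 := by
    rw [← mul_div_assoc]
    exact (div_le_one (by linarith)).2 (hqc.trans hL)
  have hlp : (1 / q) ^ p = m * (1 / q) := by
    rw [hm, ← Real.rpow_add_one hl0.ne', sub_add_cancel]
  have hyq : (m * (1 + c / L)) ^ q = m * (1 / q) * (1 + c / L) ^ q := by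
    rw [Real.mul_rpow hm0.le (by positivity), ← hlp, hm, ← Real.rpow_mul hl0.le,
      hpq.sub_one_mul_conj]
  have h1 := one_add_rpow_le hz0 hq0.le hz
  have h2 := mul_le_mul_of_nonneg_left h1 (by positivity : 0 ≤ (p - 1) * (m * (1 / q)))
  have e1 : (p - 1) * q = p := hpq.sub_one_mul_conj
  rw [hyq, hlp]
  have hqe : (p - 1) * (1 - 1 / q) = 1 / q := by field_simp; linarith
  have hfin : m * c / L ^ 2 + (p - 1) * (m * (1 + c / L)) -
      (p - 1) * (m * (1 / q)) * (1 + q * (c / L) + (q * (c / L)) ^ 2) =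
      m * (1 / q) + m * (c - p * c ^ 2) / L ^ 2 := by
    have e5 : (p - 1) * (m * (1 / q)) * (1 + q * (c / L) + (q * (c / L)) ^ 2) =
      (p - 1) * m * (1 / q) + (p - 1) * m * (c / L) + (p - 1) * q * m * (c / L) ^ 2 := by
      field_simp
    rw [e5, e1]
    calc _ = m * ((p - 1) * (1 - 1 / q)) + (m * c / L ^ 2 - p * m * (c / L) ^ 2) := by ring
      _ = _ := by rw [hqe]; field_simp
  linarith

/-! ### The Hardy inequality on a ray -/

section Ray

variable {a η : ℝ}

/-- The radial vector field `(1/q)^(p-1) * (1 + c / F(G)) * G^(1-p)` with `G = A1_{k+1}(η/t)`, which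
is tested against `|f|^p` in the Hardy inequality. -/
noncomputable def hardyField (a : ℝ) (k : ℕ) (η p q c t : ℝ) : ℝ :=
  (1 / q) ^ (p - 1) * (1 + c / F a (A1 a (k + 1) (η / t))) * A1 a (k + 1) (η / t) ^ (1 - p)

lemma hasDerivAt_hardyField (ha : 1 < a) (k : ℕ) (p q c : ℝ) {t : ℝ} (h0 : 0 < t) (h1 : t < η) :
    HasDerivAt (hardyField a k η p q c)
      (A1 a (k + 1) (η / t) ^ (-p) / weight a k 1 η t *
        ((1 / q) ^ (p - 1) * c / F a (A1 a (k + 1) (η / t)) ^ 2 +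
          (p - 1) * ((1 / q) ^ (p - 1) * (1 + c / F a (A1 a (k + 1) (η / t)))))) t := by
  have hw := weight_pos ha k h0 h1
  have hGa := le_A1 ha (k + 1) h0 h1
  have hG0 : 0 < A1 a (k + 1) (η / t) := by linarith
  have hL0 : 0 < F a (A1 a (k + 1) (η / t)) := by linarith [le_F ha hGa]
  have hG := hasDerivAt_A1 ha k h0 h1
  have hL := (hasDerivAt_F (a := a) hG0).comp t hG
  have h := (((((hL.inv hL0.ne').const_mul c).const_add 1).const_mul ((1 / q) ^ (p - 1))).mul
    (hG.rpow_const (p := 1 - p) (Or.inl hG0.ne')))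
  refine (h.congr_deriv ?_).congr_of_eventuallyEq (Eventually.of_forall fun s => ?_)
  · have e1 : A1 a (k + 1) (η / t) ^ (1 - p) =
        A1 a (k + 1) (η / t) ^ (-p) * A1 a (k + 1) (η / t) := by
      rw [← Real.rpow_add_one hG0.ne']; ring_nf
    have e2 : 1 - p - 1 = -p := by ring
    simp only [Function.comp, e2, e1, Pi.inv_apply]
    field_simp
    ring
  · simp [hardyField, div_eq_mul_inv]

lemma hardyField_nonneg (ha : 1 < a) (k : ℕ) {p q c : ℝ} (hq : 0 ≤ q) (hc : 0 ≤ c) {t : ℝ}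
    (h0 : 0 < t) (h1 : t < η) : 0 ≤ hardyField a k η p q c t := by
  have hGa := le_A1 ha (k + 1) h0 h1
  have hL0 : 0 < F a (A1 a (k + 1) (η / t)) := by linarith [le_F ha hGa]
  have hG0 : 0 < A1 a (k + 1) (η / t) := by linarith
  unfold hardyField
  positivity

lemma hardyField_le (ha : 1 < a) (k : ℕ) {p q c : ℝ} (hq : 0 ≤ q) (hc : 0 ≤ c) {t : ℝ}
    (h0 : 0 < t) (h1 : t < η) :
    hardyField a k η p q c t ≤ (1 / q) ^ (p - 1) * (1 + c) * A1 a (k + 1) (η / t) ^ (1 - p) := by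
  have hGa := le_A1 ha (k + 1) h0 h1
  have hL := le_F ha hGa
  have hG0 : 0 < A1 a (k + 1) (η / t) := by linarith
  have : c / F a (A1 a (k + 1) (η / t)) ≤ c := div_le_self hc (by linarith)
  unfold hardyField
  gcongr

/-- The Riccati-type inequality satisfied by `hardyField`; its left side is the weight that the
Hardy inequality produces. -/
lemma hardyField_riccati (ha : 1 < a) (k : ℕ) {p q c : ℝ} (hpq : p.HolderConjugate q) (hc : 0 ≤ c)
    (hqc : q * c ≤ 1) {t : ℝ} (h0 : 0 < t) (h1 : t < η) :
    A1 a (k + 1) (η / t) ^ (-p) / weight a k 1 η t *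
        ((1 / q) ^ p + (1 / q) ^ (p - 1) * (c - p * c ^ 2) / F a (A1 a (k + 1) (η / t)) ^ 2) ≤
      A1 a (k + 1) (η / t) ^ (-p) / weight a k 1 η t *
        ((1 / q) ^ (p - 1) * c / F a (A1 a (k + 1) (η / t)) ^ 2 +
          (p - 1) * ((1 / q) ^ (p - 1) * (1 + c / F a (A1 a (k + 1) (η / t))))) -
        (p - 1) * (hardyField a k η p q c t ^ q / weight a k 1 η t) := by
  have hw := weight_pos ha k h0 h1
  have hGa := le_A1 ha (k + 1) h0 h1
  have hL := le_F ha hGa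
  have hG0 : 0 < A1 a (k + 1) (η / t) := by linarith
  have hL0 : 0 < F a (A1 a (k + 1) (η / t)) := by linarith
  have hq0 := hpq.symm.pos
  have hY : hardyField a k η p q c t ^ q = ((1 / q) ^ (p - 1) *
      (1 + c / F a (A1 a (k + 1) (η / t)))) ^ q * A1 a (k + 1) (η / t) ^ (-p) := by
    have e : (1 - p) * q = -p := by linarith [hpq.sub_one_mul_conj]
    rw [hardyField, Real.mul_rpow (by positivity) (by positivity), ← Real.rpow_mul hG0.le, e]
  have h := mul_le_mul_of_nonneg_left (multiplier_ineq hpq hc hqc (ha.le.trans hL))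
    (by positivity : 0 ≤ A1 a (k + 1) (η / t) ^ (-p) / weight a k 1 η t)
  refine h.trans_eq ?_
  rw [hY]
  ring

lemma tendsto_A1_rpow_zero (ha : 1 < a) (hη : 0 < η) (k : ℕ) {p : ℝ} (hp : 1 < p) :
    Tendsto (fun t => A1 a k (η / t) ^ (1 - p)) (𝓝[>] 0) (𝓝 0) := by
  have h := (tendsto_rpow_neg_atTop (sub_pos.2 hp)).comp (tendsto_A1_zero ha hη k)
  simpa [Function.comp_def] using h

/-- The improved Hardy inequality on a ray. Here `d` is an upper bound of `|f'|`; along a ray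
through the origin it is the norm of the full gradient. -/
lemma ray_hardy (ha : 1 < a) (hη : 0 < η) (k : ℕ) {p q c : ℝ} (hpq : p.HolderConjugate q)
    (hc : 0 ≤ c) (hqc : q * c ≤ 1) {f f' d : ℝ → ℝ} (hf : Continuous f)
    (hf' : ∀ t ∈ Ioo 0 η, HasDerivAt f (f' t) t) (hd : ∀ t ∈ Ioo 0 η, |f' t| ≤ d t)
    (hfη : f η = 0) {φ : ℝ → ℝ}
    (hφ : ∀ t ∈ Ioo 0 η, φ t = d t ^ p * weight a k 1 η t ^ (p - 1) -
      |f t| ^ p * (A1 a (k + 1) (η / t) ^ (-p) / weight a k 1 η t *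
        ((1 / q) ^ p + (1 / q) ^ (p - 1) * (c - p * c ^ 2) / F a (A1 a (k + 1) (η / t)) ^ 2))) :
    0 ≤ ∫ t in Ioo 0 η, φ t := by
  by_cases hint : IntegrableOn φ (Ioo 0 η)
  swap
  · rw [integral_undef hint]
  have hp := hpq.lt
  have hq0 := hpq.symm.pos
  set Y := hardyField a k η p q c with hY
  -- The boundary terms vanish: at `0` because `A1 → ∞`, at `η` because `f` does.
  have hbound : ∀ t ∈ Ioo 0 η, |f t| ^ p * Y t ≤
      (1 / q) ^ (p - 1) * (1 + c) * (|f t| ^ p * A1 a (k + 1) (η / t) ^ (1 - p)) := by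
    intro t ht
    have := mul_le_mul_of_nonneg_left (hardyField_le ha k (p := p) hq0.le hc ht.1 ht.2)
      (Real.rpow_nonneg (abs_nonneg (f t)) p)
    linarith
  have hnn : ∀ t ∈ Ioo 0 η, 0 ≤ |f t| ^ p * Y t := fun t ht =>
    mul_nonneg (Real.rpow_nonneg (abs_nonneg _) p) (hardyField_nonneg ha k hq0.le hc ht.1 ht.2)
  have hfp : Continuous fun t => |f t| ^ p := hf.abs.rpow_const fun _ => Or.inr (by linarith)
  have lim0 : Tendsto (fun t => |f t| ^ p * Y t) (𝓝[>] 0) (𝓝 0) := by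
    have h1 : Tendsto (fun t => (1 / q) ^ (p - 1) * (1 + c) *
        (|f t| ^ p * A1 a (k + 1) (η / t) ^ (1 - p))) (𝓝[>] 0) (𝓝 0) := by
      have := (((hfp.tendsto 0).mono_left nhdsWithin_le_nhds).mul
        (tendsto_A1_rpow_zero ha hη (k + 1) hp)).const_mul ((1 / q) ^ (p - 1) * (1 + c))
      simpa using this
    have hmem : Ioo 0 η ∈ 𝓝[>] (0 : ℝ) := Ioo_mem_nhdsGT hη
    exact tendsto_of_tendsto_of_tendsto_of_le_of_le' tendsto_const_nhds h1
      (by filter_upwards [hmem] with t ht using hnn t ht)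
      (by filter_upwards [hmem] with t ht using hbound t ht)
  have limη : Tendsto (fun t => |f t| ^ p * Y t) (𝓝[<] η) (𝓝 0) := by
    have h1 : Tendsto (fun t => (1 / q) ^ (p - 1) * (1 + c) *
        (|f t| ^ p * A1 a (k + 1) (η / t) ^ (1 - p))) (𝓝[<] η) (𝓝 0) := by
      have := (((hfp.tendsto η).mono_left nhdsWithin_le_nhds).mul
        ((tendsto_A1_radius ha hη (k + 1)).rpow_const (p := 1 - p)
          (Or.inl (by linarith : (0 : ℝ) < a).ne'))).const_mul ((1 / q) ^ (p - 1) * (1 + c))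
      simpa [hfη, Real.zero_rpow (by linarith : p ≠ 0)] using this
    have hmem : Ioo 0 η ∈ 𝓝[<] η := Ioo_mem_nhdsLT hη
    exact tendsto_of_tendsto_of_tendsto_of_le_of_le' tendsto_const_nhds h1
      (by filter_upwards [hmem] with t ht using hnn t ht)
      (by filter_upwards [hmem] with t ht using hbound t ht)
  have main := sub_le_setIntegral_Ioo_of_tendsto (f := fun t => -(|f t| ^ p * Y t)) hη
    (fun t ht => (((hasDerivAt_abs_rpow (f t) hp).comp t (hf' t ht)).mul
      (hasDerivAt_hardyField ha k p q c ht.1 ht.2)).neg) lim0.neg limη.neg hint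
    (fun t ht => ?_)
  · simpa using main
  have hw := weight_pos ha k ht.1 ht.2
  have hYt := hardyField_nonneg ha k (p := p) hq0.le hc ht.1 ht.2
  have hric := mul_le_mul_of_nonneg_left (hardyField_riccati ha k hpq hc hqc ht.1 ht.2)
    (Real.rpow_nonneg (abs_nonneg (f t)) p)
  have hy := young_weighted hpq ((abs_nonneg _).trans (hd t ht)) (abs_nonneg (f t)) hYt hw
  have hdir : -(p * |f t| ^ (p - 2) * f t * f' t) ≤ p * d t * |f t| ^ (p - 1) := by
    have e : |f t| ^ (p - 2) * |f t| = |f t| ^ (p - 1) := by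
      rcases (abs_nonneg (f t)).eq_or_lt with h | h
      · rw [← h, Real.zero_rpow (by linarith : p - 1 ≠ 0), mul_zero]
      · rw [← Real.rpow_add_one h.ne']; ring_nf
    calc -(p * |f t| ^ (p - 2) * f t * f' t) ≤ |p * |f t| ^ (p - 2) * f t * f' t| := neg_le_abs _
      _ = p * (|f t| ^ (p - 2) * |f t|) * |f' t| := by
        rw [abs_mul, abs_mul, abs_mul, abs_of_pos hpq.pos,
          abs_of_nonneg (Real.rpow_nonneg (abs_nonneg (f t)) _)]
        ring
      _ ≤ p * |f t| ^ (p - 1) * d t := by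
        rw [e]
        exact mul_le_mul_of_nonneg_left (hd t ht)
          (mul_nonneg hpq.nonneg (Real.rpow_nonneg (abs_nonneg _) _))
      _ = _ := by ring
  have hdir' := mul_le_mul_of_nonneg_right hdir hYt
  rw [hφ t ht]
  simp only [Function.comp, ← hY] at *
  have e6 : (p - 1) * (|f t| ^ p * Y t ^ q / weight a k 1 η t) =
    |f t| ^ p * ((p - 1) * (Y t ^ q / weight a k 1 η t)) := by ring
  rw [e6] at hy
  linarith

/-- The Hardy weight is integrable: `1 / (w A1_{k+1}^p)` is the derivative of
`A1_{k+1}^(1-p) / (p-1)`. -/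
lemma integrableOn_hardyWeight (ha : 1 < a) (hη : 0 < η) (k : ℕ) {p : ℝ} (hp : 1 < p) :
    IntegrableOn (fun t => A1 a (k + 1) (η / t) ^ (-p) / weight a k 1 η t) (Ioo 0 η) := by
  have h := integrableOn_Ioo_deriv_of_nonneg
    (f := fun t => A1 a (k + 1) (η / t) ^ (1 - p))
    (f' := fun t => (p - 1) * (A1 a (k + 1) (η / t) ^ (-p) / weight a k 1 η t))
    hη (fun t ht => ?_) (tendsto_A1_rpow_zero ha hη (k + 1) hp)
    ((tendsto_A1_radius ha hη (k + 1)).rpow_const (Or.inl (by linarith : (0 : ℝ) < a).ne'))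
    (fun t ht => ?_)
  · have := h.const_mul (p - 1)⁻¹
    have hp' : p - 1 ≠ 0 := by linarith
    simpa [IntegrableOn, ← mul_assoc, inv_mul_cancel₀ hp'] using this
  · have hG0 : 0 < A1 a (k + 1) (η / t) := by linarith [le_A1 ha (k + 1) ht.1 ht.2]
    refine ((hasDerivAt_A1 ha k ht.1 ht.2).rpow_const (p := 1 - p)
      (Or.inl hG0.ne')).congr_deriv ?_
    have e2 : 1 - p - 1 = -p := by ring
    rw [e2]; ring
  · have hG0 : 0 < A1 a (k + 1) (η / t) := by linarith [le_A1 ha (k + 1) ht.1 ht.2]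
    have := weight_pos ha k ht.1 ht.2
    have hp' : 0 ≤ p - 1 := by linarith
    positivity

lemma integrableOn_weight_rpow (ha : 1 < a) (hη : 0 < η) (k : ℕ) {s : ℝ} (hs : 0 ≤ s) :
    IntegrableOn (fun t => weight a k 1 η t ^ s) (Ioo 0 η) := by
  obtain ⟨M, hM⟩ := exists_weight_le ha hη k
  refine Integrable.of_bound (((continuousOn_weight ha k).rpow_const
    fun _ _ => Or.inr hs).aestronglyMeasurable measurableSet_Ioo) (M ^ s) ?_
  filter_upwards [ae_restrict_mem measurableSet_Ioo] with t ht
  have := (weight_pos ha k ht.1 ht.2).le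
  rw [Real.norm_of_nonneg (by positivity)]
  exact Real.rpow_le_rpow this (hM t ht) hs

end Ray

/-! ### Polar coordinates -/

section Polar

variable {n : ℕ}

/-- An integral over a ball is nonnegative if the integrals along all its radii, with the Jacobian
of the polar coordinates, are. -/
lemma setIntegral_ball_nonneg_of_rays {E : Type*} [NormedAddCommGroup E] [NormedSpace ℝ E]
    [FiniteDimensional ℝ E] [Nontrivial E] [MeasurableSpace E] [BorelSpace E] (μ : Measure E)
    [μ.IsAddHaarMeasure] {η : ℝ} {f : E → ℝ} (hf : IntegrableOn f (Metric.ball 0 η) μ)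
    (hray : ∀ θ : E, ‖θ‖ = 1 → 0 ≤ ∫ t in Ioo 0 η, t ^ (Module.finrank ℝ E - 1) * f (t • θ)) :
    0 ≤ ∫ x in Metric.ball 0 η, f x ∂μ := by
  set g : E → ℝ := (Metric.ball 0 η).indicator f with hg
  have hgint : Integrable g μ := (integrable_indicator_iff measurableSet_ball).2 hf
  set h : Metric.sphere (0 : E) 1 × Ioi (0 : ℝ) → ℝ := fun z => g (z.2.1 • z.1.1) with hh
  have hpres := μ.measurePreserving_homeomorphUnitSphereProd
  have hemb := (homeomorphUnitSphereProd E).measurableEmbedding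
  have hcomp : ∀ x : ({0}ᶜ : Set E), h (homeomorphUnitSphereProd E x) = g x.1 := by
    intro x
    have hx : ‖x.1‖ ≠ 0 := norm_ne_zero_iff.2 x.2
    simp [hh, smul_smul, mul_inv_cancel₀ hx]
  have hhint : Integrable h (μ.toSphere.prod (.volumeIoiPow (Module.finrank ℝ E - 1))) := by
    rw [← hpres.integrable_comp_emb hemb]
    have : h ∘ homeomorphUnitSphereProd E = g ∘ (↑) := funext hcomp
    rw [this, ← integrableOn_iff_comap_subtypeVal (measurableSet_singleton _).compl]
    exact hgint.integrableOn
  have hpol : ∫ x, g x ∂μ =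
      ∫ z, h z ∂(μ.toSphere.prod (.volumeIoiPow (Module.finrank ℝ E - 1))) := by
    rw [← hpres.integral_comp hemb]
    simp only [hcomp]
    rw [integral_subtype_comap (measurableSet_singleton _).compl g, restrict_compl_singleton]
  rw [← integral_indicator measurableSet_ball, hpol, integral_prod _ hhint]
  refine integral_nonneg fun θ => ?_
  have hθ : ‖θ.1‖ = 1 := by simp
  have key : ∫ r : Ioi (0 : ℝ), h (θ, r) ∂(.volumeIoiPow (Module.finrank ℝ E - 1)) =
      ∫ t in Ioo 0 η, t ^ (Module.finrank ℝ E - 1) * f (t • θ.1) := by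
    simp only [Measure.volumeIoiPow, ENNReal.ofReal]
    rw [integral_withDensity_eq_integral_smul
      (measurable_subtype_coe.pow_const _).real_toNNReal]
    have := integral_subtype_comap (s := Ioi (0 : ℝ)) (μ := volume) measurableSet_Ioi fun t : ℝ =>
      Real.toNNReal (t ^ (Module.finrank ℝ E - 1)) • g (t • θ.1)
    rw [this, ← Ioi_inter_Iio, ← setIntegral_indicator measurableSet_Iio]
    refine setIntegral_congr_fun measurableSet_Ioi fun t (ht : 0 < t) => ?_
    have hnorm : ‖t • θ.1‖ = t := by rw [norm_smul, hθ, mul_one, Real.norm_of_nonneg ht.le]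
    simp only [NNReal.smul_def, Real.coe_toNNReal _ (pow_nonneg ht.le _), smul_eq_mul,
      hg, indicator, mem_ball_zero_iff, hnorm, mem_Iio]
    split_ifs <;> simp
  simp only [key]
  exact hray _ hθ

lemma pow_mul_rpow_one_sub {n : ℕ} (hn : 1 ≤ n) {t : ℝ} (ht : 0 < t) :
    t ^ (n - 1) * t ^ (1 - (n : ℝ)) = 1 := by
  rw [← Real.rpow_natCast, ← Real.rpow_add ht, Nat.cast_sub hn]
  simp

/-- The factor `‖x‖^(1-n)` compensates the Jacobian of the polar coordinates, so the integrability
of a bounded multiple of a radial function reduces to one dimension. -/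
lemma integrableOn_mul_radial (hn : 1 ≤ n) {η : ℝ} {b : EuclideanSpace ℝ (Fin n) → ℝ}
    (hb : Continuous b) {ρ : ℝ → ℝ} (hρ : IntegrableOn ρ (Ioo 0 η)) :
    IntegrableOn (fun x => b x * (ρ ‖x‖ * ‖x‖ ^ (1 - (n : ℝ)))) (Metric.ball 0 η) := by
  have : Nonempty (Fin n) := ⟨⟨0, hn⟩⟩
  have hrad : IntegrableOn (fun x : EuclideanSpace ℝ (Fin n) => ρ ‖x‖ * ‖x‖ ^ (1 - (n : ℝ)))
      (Metric.ball 0 η) := by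
    rw [integrableOn_fun_norm_addHaar volume (f := fun t => ρ t * t ^ (1 - (n : ℝ)))]
    refine hρ.congr_fun (fun t ht => ?_) measurableSet_Ioo
    simp only [finrank_euclideanSpace_fin, smul_eq_mul]
    rw [mul_left_comm, pow_mul_rpow_one_sub hn ht.1, mul_one]
  obtain ⟨C, hC⟩ :=
    (isCompact_closedBall (0 : EuclideanSpace ℝ (Fin n)) η).exists_bound_of_continuousOn
      hb.continuousOn
  refine Integrable.bdd_mul (c := C) hrad hb.aestronglyMeasurable ?_
  filter_upwards [ae_restrict_mem measurableSet_ball] with x hx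
  exact hC x (Metric.ball_subset_closedBall hx)

end Polar

/-! ### The improved Hardy inequality on the ball -/

section Ball

variable {n : ℕ} {a η p : ℝ} {u : EuclideanSpace ℝ (Fin n) → ℝ}

lemma norm_gradient (x : EuclideanSpace ℝ (Fin n)) : ‖gradient u x‖ = ‖fderiv ℝ u x‖ :=
  LinearIsometryEquiv.norm_map _ _

lemma continuous_norm_gradient_rpow (hu : IsTestFunction η u) (hp : 0 ≤ p) :
    Continuous fun x => ‖gradient u x‖ ^ p := by
  simp only [norm_gradient]
  exact (hu.smooth.continuous_fderiv (by simp)).norm.rpow_const fun _ => Or.inr hp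

lemma integrableOn_energyDensity (ha : 1 < a) (hη : 0 < η) (k : ℕ) (hp : 1 < p) (hn : 1 ≤ n)
    (hu : IsTestFunction η u) : IntegrableOn (energyDensity a k η p u) (Metric.ball 0 η) := by
  refine (integrableOn_mul_radial hn (continuous_norm_gradient_rpow hu (by linarith : 0 ≤ p))
    (integrableOn_weight_rpow ha hη k (sub_nonneg.2 hp.le))).congr
    (Eventually.of_forall fun x => ?_)
  simp only [energyDensity, mul_assoc]

lemma continuous_abs_rpow (hu : IsTestFunction η u) (hp : 0 ≤ p) :
    Continuous fun x => |u x| ^ p :=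
  hu.smooth.continuous.abs.rpow_const fun _ => Or.inr hp

lemma integrableOn_one_div_hardyWeight (ha : 1 < a) (hη : 0 < η) (k : ℕ) (hp : 1 < p) :
    IntegrableOn (fun t => 1 / (weight a k 1 η t * A1 a (k + 1) (η / t) ^ p)) (Ioo 0 η) := by
  refine (integrableOn_hardyWeight ha hη k hp).congr_fun (fun t ht => ?_) measurableSet_Ioo
  have hG0 : 0 < A1 a (k + 1) (η / t) := by linarith [le_A1 ha (k + 1) ht.1 ht.2]
  simp only [Real.rpow_neg hG0.le]
  field_simp

lemma integrableOn_hardyDensity (ha : 1 < a) (hη : 0 < η) (k : ℕ) (hp : 1 < p) (hn : 1 ≤ n)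
    (hu : IsTestFunction η u) : IntegrableOn (hardyDensity a k η p u) (Metric.ball 0 η) := by
  refine (integrableOn_mul_radial hn (continuous_abs_rpow hu (by linarith : 0 ≤ p))
    (integrableOn_one_div_hardyWeight ha hη k hp)).congr (Eventually.of_forall fun x => ?_)
  simp only [hardyDensity]
  ring

lemma integrableOn_remainderDensity (ha : 1 < a) (hη : 0 < η) (k : ℕ) (hp : 1 < p) (hn : 1 ≤ n)
    (hu : IsTestFunction η u) : IntegrableOn (remainderDensity a k η p u) (Metric.ball 0 η) := by
  have hint : IntegrableOn (fun t => 1 / F a (A1 a (k + 1) (η / t)) ^ 2 *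
      (1 / (weight a k 1 η t * A1 a (k + 1) (η / t) ^ p))) (Ioo 0 η) := by
    refine Integrable.bdd_mul (c := 1) (integrableOn_one_div_hardyWeight ha hη k hp)
      (ContinuousOn.aestronglyMeasurable (fun t ht => ?_) measurableSet_Ioo) ?_
    · have hGa := le_A1 ha (k + 1) ht.1 ht.2
      have hL : 0 < F a (A1 a (k + 1) (η / t)) := by linarith [le_F ha hGa]
      have h1 : ContinuousWithinAt (fun t => F a (A1 a (k + 1) (η / t))) (Ioo 0 η) t :=
        (hasDerivAt_F (by linarith)).continuousAt.comp_continuousWithinAt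
          (continuousOn_A1 ha (k + 1) t ht)
      exact continuousWithinAt_const.div (h1.pow 2) (by positivity)
    · filter_upwards [ae_restrict_mem measurableSet_Ioo] with t ht
      have hL := le_F ha (le_A1 ha (k + 1) ht.1 ht.2)
      have h1 : 1 ≤ F a (A1 a (k + 1) (η / t)) ^ 2 := by nlinarith
      rw [Real.norm_of_nonneg (by positivity)]
      exact (div_le_one (by linarith)).2 h1
  refine (integrableOn_mul_radial hn (continuous_abs_rpow hu (by linarith : 0 ≤ p))
    hint).congr (Eventually.of_forall fun x => ?_)
  have hFe : a - Real.log a + Real.log (A1 a (k + 1) (η / ‖x‖)) =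
    F a (A1 a (k + 1) (η / ‖x‖)) := rfl
  simp only [remainderDensity, hFe]
  ring

lemma ball_hardy (ha : 1 < a) (hη : 0 < η) (k : ℕ) {q c : ℝ} (hpq : p.HolderConjugate q)
    (hc : 0 ≤ c) (hqc : q * c ≤ 1) (hn : 1 ≤ n) (hu : IsTestFunction η u) :
    (1 / q) ^ p * (∫ x in Metric.ball 0 η, hardyDensity a k η p u x) +
        (1 / q) ^ (p - 1) * (c - p * c ^ 2) *
          (∫ x in Metric.ball 0 η, remainderDensity a k η p u x) ≤
      ∫ x in Metric.ball 0 η, energyDensity a k η p u x := by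
  have : Nonempty (Fin n) := ⟨⟨0, hn⟩⟩
  have hE := integrableOn_energyDensity ha hη k hpq.lt hn hu
  have hH := integrableOn_hardyDensity ha hη k hpq.lt hn hu
  have hR := integrableOn_remainderDensity ha hη k hpq.lt hn hu
  set C := (1 / q) ^ (p - 1) * (c - p * c ^ 2) with hC
  have hsum : Integrable (fun x => (1 / q) ^ p * hardyDensity a k η p u x +
      C * remainderDensity a k η p u x) (volume.restrict (Metric.ball 0 η)) :=
    (hH.const_mul _).add (hR.const_mul _)
  have key := setIntegral_ball_nonneg_of_rays volume (f := fun x => energyDensity a k η p u x -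
    ((1 / q) ^ p * hardyDensity a k η p u x + C * remainderDensity a k η p u x))
    (hE.sub hsum) fun θ hθ => ?_
  · rw [integral_sub hE hsum, integral_add (hH.const_mul _) (hR.const_mul _), integral_const_mul,
      integral_const_mul] at key
    linarith
  rw [finrank_euclideanSpace_fin]
  have hdiff : Differentiable ℝ u := hu.smooth.differentiable (by simp)
  refine ray_hardy ha hη k hpq hc hqc (f := fun t => u (t • θ))
    (f' := fun t => fderiv ℝ u (t • θ) θ) (d := fun t => ‖gradient u (t • θ)‖)
    (hu.smooth.continuous.comp (by fun_prop)) (fun t _ => ?_) (fun t _ => ?_) ?_ fun t ht => ?_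
  · have h := (hasDerivAt_id t).smul_const θ
    simp only [id, one_smul] at h
    exact (hdiff (t • θ)).hasFDerivAt.comp_hasDerivAt t h
  · rw [norm_gradient, ← Real.norm_eq_abs]
    simpa [hθ] using (fderiv ℝ u (t • θ)).le_opNorm θ
  · refine image_eq_zero_of_notMem_tsupport fun hmem => ?_
    have := hu.supported hmem
    rw [mem_ball_zero_iff, norm_smul, hθ, mul_one, Real.norm_of_nonneg hη.le] at this
    exact lt_irrefl _ this
  · have hnorm : ‖t • θ‖ = t := by rw [norm_smul, hθ, mul_one, Real.norm_of_nonneg ht.1.le]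
    have hJ := pow_mul_rpow_one_sub hn ht.1
    have hGa := le_A1 ha (k + 1) ht.1 ht.2
    have hG0 : 0 < A1 a (k + 1) (η / t) := by linarith
    have hL0 : 0 < F a (A1 a (k + 1) (η / t)) := by linarith [le_F ha hGa]
    have hw := weight_pos ha k ht.1 ht.2
    have hGp : 0 < A1 a (k + 1) (η / t) ^ p := by positivity
    have hFe : a - Real.log a + Real.log (A1 a (k + 1) (η / t)) =
      F a (A1 a (k + 1) (η / t)) := rfl
    simp only [energyDensity, hardyDensity, remainderDensity, hnorm, hFe, Real.rpow_neg hG0.le]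
    rw [← hC]
    calc _ = (t ^ (n - 1) * t ^ (1 - (n : ℝ))) * (‖gradient u (t • θ)‖ ^ p *
          weight a k 1 η t ^ (p - 1) - ((1 / q) ^ p * (|u (t • θ)| ^ p /
            (weight a k 1 η t * A1 a (k + 1) (η / t) ^ p)) + C * (|u (t • θ)| ^ p /
            (weight a k 1 η t * A1 a (k + 1) (η / t) ^ p * F a (A1 a (k + 1) (η / t)) ^ 2)))) := by
          ring
      _ = _ := by
        rw [hJ, one_mul]
        field_simp

end Ball

/-! ### Smooth approximation of compactly supported `C¹` functions -/

lemma exists_contDiff_approx {f f' : ℝ → ℝ} (hf : ∀ t, HasDerivAt f (f' t) t)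
    (hf' : Continuous f') {α β : ℝ} (hsupp : ∀ t ∉ Icc α β, f t = 0) {δ ε : ℝ} (hδ : 0 < δ)
    (hε : 0 < ε) :
    ∃ h : ℝ → ℝ, ContDiff ℝ ∞ h ∧ (∀ t ∉ Icc (α - δ) (β + δ), h t = 0) ∧
      (∀ t, |h t - f t| ≤ ε) ∧ ∀ t, |deriv h t - f' t| ≤ ε := by
  have hfc : Continuous f := continuous_iff_continuousAt.2 fun t => (hf t).continuousAt
  have hderiv : deriv f = f' := funext fun t => (hf t).deriv
  have hcs : HasCompactSupport f := HasCompactSupport.intro isCompact_Icc fun t ht => hsupp t ht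
  have hcs' : HasCompactSupport f' := hderiv ▸ hcs.deriv
  have hC1 : ContDiff ℝ 1 f :=
    contDiff_one_iff_deriv.2 ⟨fun t => (hf t).differentiableAt, hderiv ▸ hf'⟩
  obtain ⟨r, hr, hfr⟩ := Metric.uniformContinuous_iff.1
    (hcs.uniformContinuous_of_continuous hfc) ε hε
  obtain ⟨r', hr', hfr'⟩ := Metric.uniformContinuous_iff.1
    (hcs'.uniformContinuous_of_continuous hf') ε hε
  set ρ := min δ (min r r') with hρ
  have hρ0 : 0 < ρ := lt_min hδ (lt_min hr hr')
  let φ : ContDiffBump (0 : ℝ) := ⟨ρ / 2, ρ, half_pos hρ0, half_lt_self hρ0⟩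
  refine ⟨MeasureTheory.convolution (φ.normed volume) f (ContinuousLinearMap.lsmul ℝ ℝ) volume,
    φ.hasCompactSupport_normed.contDiff_convolution_left _ φ.contDiff_normed
      hfc.locallyIntegrable, fun t ht => ?_, fun t => ?_, fun t => ?_⟩
  · have hzero : ∀ x ∈ Metric.ball t φ.rOut, f x = 0 := by
      intro x hx
      refine hsupp x fun hx' => ht ?_
      have h1 : |x - t| < ρ := by simpa [Real.dist_eq] using hx
      have h2 : ρ ≤ δ := min_le_left _ _
      have h3 := abs_lt.1 h1
      exact ⟨by linarith [hx'.1], by linarith [hx'.2]⟩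
    have h0 := hzero t (Metric.mem_ball_self φ.rOut_pos)
    have := φ.dist_normed_convolution_le (ε := 0) (μ := volume) (x₀ := t) hfc.aestronglyMeasurable
      fun x hx => by rw [hzero x hx, h0, dist_self]
    rw [h0] at this
    exact dist_le_zero.1 this
  · rw [← Real.dist_eq]
    refine φ.dist_normed_convolution_le hfc.aestronglyMeasurable fun x hx => (hfr ?_).le
    exact lt_of_lt_of_le (Metric.mem_ball.1 hx) ((min_le_right _ _).trans (min_le_left _ _))
  · rw [(hcs.hasDerivAt_convolution_right (ContinuousLinearMap.lsmul ℝ ℝ)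
      φ.continuous_normed.locallyIntegrable hC1 t).deriv, hderiv, ← Real.dist_eq]
    refine φ.dist_normed_convolution_le hf'.aestronglyMeasurable fun x hx => (hfr' ?_).le
    exact lt_of_lt_of_le (Metric.mem_ball.1 hx) ((min_le_right _ _).trans (min_le_right _ _))

/-! ### Radial test functions -/

section Radial

variable {n : ℕ}

lemma setIntegral_ball_radial (hn : 1 ≤ n) (ρ : ℝ → ℝ) (η : ℝ) :
    ∫ x in Metric.ball (0 : EuclideanSpace ℝ (Fin n)) η, ρ ‖x‖ * ‖x‖ ^ (1 - (n : ℝ)) =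
      n * volume.real (Metric.ball (0 : EuclideanSpace ℝ (Fin n)) 1) * ∫ t in Ioo 0 η, ρ t := by
  have : Nonempty (Fin n) := ⟨⟨0, hn⟩⟩
  have h1 : (Metric.ball (0 : EuclideanSpace ℝ (Fin n)) η).indicator
      (fun x => ρ ‖x‖ * ‖x‖ ^ (1 - (n : ℝ))) =
      fun x => (Iio η).indicator (fun t => ρ t * t ^ (1 - (n : ℝ))) ‖x‖ := by
    funext x
    simp [indicator]
  rw [← integral_indicator measurableSet_ball, h1, integral_fun_norm_addHaar volume,
    finrank_euclideanSpace_fin, nsmul_eq_mul, smul_eq_mul, ← mul_assoc, ← Ioi_inter_Iio,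
    ← setIntegral_indicator measurableSet_Iio]
  congr 1
  refine setIntegral_congr_fun measurableSet_Ioi fun t ht => ?_
  simp only [indicator, smul_eq_mul]
  split_ifs
  · rw [mul_left_comm, pow_mul_rpow_one_sub hn ht, mul_one]
  · simp

variable {α β η : ℝ} {h : ℝ → ℝ}

lemma isTestFunction_radial (hα : 0 < α) (hβ : β < η) (hh : ContDiff ℝ ∞ h)
    (hsupp : ∀ t ∉ Icc α β, h t = 0) :
    IsTestFunction η fun x : EuclideanSpace ℝ (Fin n) => h ‖x‖ := by
  have hts : tsupport (fun x : EuclideanSpace ℝ (Fin n) => h ‖x‖) ⊆ Metric.closedBall 0 β := by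
    refine closure_minimal (fun x hx => ?_) Metric.isClosed_closedBall
    by_contra hx'
    exact hx (hsupp _ fun hm => hx' (mem_closedBall_zero_iff.2 hm.2))
  refine ⟨contDiff_iff_contDiffAt.2 fun x => ?_,
    HasCompactSupport.of_support_subset_isCompact (isCompact_closedBall 0 β)
      ((subset_tsupport _).trans hts),
    hts.trans (Metric.closedBall_subset_ball hβ)⟩
  by_cases hx : x = 0
  · refine (contDiffAt_const (c := (0 : ℝ))).congr_of_eventuallyEq ?_
    filter_upwards [Metric.ball_mem_nhds x hα] with y hy
    rw [hx, mem_ball_zero_iff] at hy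
    exact hsupp _ fun hm => absurd hm.1 (not_le.2 hy)
  · exact hh.contDiffAt.comp x (contDiffAt_norm ℝ hx)

lemma norm_gradient_radial (hn : 1 ≤ n) (hα : 0 < α) (hh : ContDiff ℝ ∞ h)
    (hsupp : ∀ t ∉ Icc α β, h t = 0) (x : EuclideanSpace ℝ (Fin n)) :
    ‖gradient (fun x : EuclideanSpace ℝ (Fin n) => h ‖x‖) x‖ = |deriv h ‖x‖| := by
  have : Nonempty (Fin n) := ⟨⟨0, hn⟩⟩
  rw [norm_gradient]
  by_cases hx : x = 0
  · have h1 : (fun x : EuclideanSpace ℝ (Fin n) => h ‖x‖) =ᶠ[𝓝 x] fun _ => (0 : ℝ) := by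
      filter_upwards [Metric.ball_mem_nhds x hα] with y hy
      rw [hx, mem_ball_zero_iff] at hy
      exact hsupp _ fun hm => absurd hm.1 (not_le.2 hy)
    have h2 : h =ᶠ[𝓝 ‖x‖] fun _ => (0 : ℝ) := by
      rw [hx, norm_zero]
      filter_upwards [Iio_mem_nhds hα] with t ht
      exact hsupp _ fun hm => absurd hm.1 (not_le.2 ht)
    rw [h1.fderiv_eq, h2.deriv_eq]
    simp
  · have hd : DifferentiableAt ℝ (‖·‖) x :=
      (contDiffAt_norm ℝ hx (n := 1)).differentiableAt (by simp)
    have hc := ((hh.differentiable (by simp)) ‖x‖).hasDerivAt.comp_hasFDerivAt x hd.hasFDerivAt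
    rw [HasFDerivAt.fderiv (f := fun x => h ‖x‖) hc, norm_smul, norm_fderiv_norm hd, mul_one,
      Real.norm_eq_abs]

variable {a p : ℝ}

lemma setIntegral_energyDensity_radial (hn : 1 ≤ n) (k : ℕ) (hα : 0 < α) (hh : ContDiff ℝ ∞ h)
    (hsupp : ∀ t ∉ Icc α β, h t = 0) :
    ∫ x in Metric.ball 0 η, energyDensity a k η p
        (fun x : EuclideanSpace ℝ (Fin n) => h ‖x‖) x =
      n * volume.real (Metric.ball (0 : EuclideanSpace ℝ (Fin n)) 1) *
        ∫ t in Ioo 0 η, |deriv h t| ^ p * weight a k 1 η t ^ (p - 1) := by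
  rw [← setIntegral_ball_radial hn]
  simp only [energyDensity, norm_gradient_radial hn hα hh hsupp]

lemma setIntegral_hardyDensity_radial (hn : 1 ≤ n) (k : ℕ) :
    ∫ x in Metric.ball 0 η, hardyDensity a k η p
        (fun x : EuclideanSpace ℝ (Fin n) => h ‖x‖) x =
      n * volume.real (Metric.ball (0 : EuclideanSpace ℝ (Fin n)) 1) *
        ∫ t in Ioo 0 η, |h t| ^ p * (1 / (weight a k 1 η t * A1 a (k + 1) (η / t) ^ p)) := by
  rw [← setIntegral_ball_radial hn]
  congr 1
  funext x
  simp only [hardyDensity]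
  ring

end Radial

/-! ### Almost extremal functions -/

section Sharp

variable {a η : ℝ}

/-- The substitution `s = δ * log A1_{k+1}(η/t)`. -/
lemma setIntegral_comp_log_A1 (ha : 1 < a) (hη : 0 < η) (k : ℕ) {Θ : ℝ → ℝ} (hΘ : Continuous Θ)
    (hpos : ∀ s, 0 ≤ Θ s) (hsupp : ∀ s ∉ Icc (1 : ℝ) 3, Θ s = 0) {δ : ℝ} (hδ : 0 < δ)
    (hδa : δ * Real.log a < 1) :
    ∫ t in Ioo 0 η, Θ (δ * Real.log (A1 a (k + 1) (η / t))) /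
        (weight a k 1 η t * A1 a (k + 1) (η / t)) = δ⁻¹ * ∫ s in (1 : ℝ)..3, Θ s := by
  set T : ℝ → ℝ := fun s => ∫ r in (1 : ℝ)..s, Θ r with hT
  have hTd : ∀ s, HasDerivAt T (Θ s) s := fun s =>
    intervalIntegral.integral_hasDerivAt_right (hΘ.intervalIntegrable _ _)
      (hΘ.stronglyMeasurableAtFilter _ _) hΘ.continuousAt
  have hT1 : ∀ s ≤ 1, T s = 0 := by
    intro s hs
    refine intervalIntegral.integral_zero_ae ?_
    filter_upwards [compl_mem_ae_iff.2 (measure_singleton (1 : ℝ))] with r hr hr'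
    rw [uIoc_of_ge hs] at hr'
    exact hsupp r fun hm => hr (le_antisymm hr'.2 hm.1)
  have hT3 : ∀ s, 3 ≤ s → T s = T 3 := by
    intro s hs
    have h1 : ∫ r in (3 : ℝ)..s, Θ r = 0 := by
      refine intervalIntegral.integral_zero_ae (Eventually.of_forall fun r hr => ?_)
      rw [uIoc_of_le hs] at hr
      exact hsupp r fun hm => absurd hm.2 (not_le.2 hr.1)
    have := intervalIntegral.integral_add_adjacent_intervals (μ := volume)
      (hΘ.intervalIntegrable 1 3) (hΘ.intervalIntegrable 3 s)
    simp only [hT]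
    linarith
  have hder : ∀ t ∈ Ioo 0 η, HasDerivAt
      (fun t => -δ⁻¹ * T (δ * Real.log (A1 a (k + 1) (η / t))))
      (Θ (δ * Real.log (A1 a (k + 1) (η / t))) / (weight a k 1 η t * A1 a (k + 1) (η / t))) t := by
    intro t ht
    have hG0 : 0 < A1 a (k + 1) (η / t) := by linarith [le_A1 ha (k + 1) ht.1 ht.2]
    have hw := weight_pos ha k ht.1 ht.2
    have h1 := ((hasDerivAt_A1 ha k ht.1 ht.2).log hG0.ne').const_mul δ
    refine (((hTd _).comp t h1).const_mul (-δ⁻¹)).congr_deriv ?_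
    field_simp
  have lim0 : Tendsto (fun t => -δ⁻¹ * T (δ * Real.log (A1 a (k + 1) (η / t)))) (𝓝[>] 0)
      (𝓝 (-δ⁻¹ * T 3)) := by
    have h1 := (Real.tendsto_log_atTop.comp (tendsto_A1_zero ha hη (k + 1))).const_mul_atTop hδ
    refine tendsto_const_nhds.congr' ?_
    filter_upwards [h1.eventually_ge_atTop 3] with t ht
    rw [hT3 (δ * Real.log (A1 a (k + 1) (η / t))) ht]
  have limη : Tendsto (fun t => -δ⁻¹ * T (δ * Real.log (A1 a (k + 1) (η / t)))) (𝓝[<] η)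
      (𝓝 0) := by
    have h1 := ((tendsto_A1_radius ha hη (k + 1)).log (by linarith)).const_mul δ
    refine tendsto_const_nhds.congr' ?_
    filter_upwards [h1.eventually_lt_const hδa] with t ht
    rw [hT1 _ ht.le, mul_zero]
  have hint := integrableOn_Ioo_deriv_of_nonneg hη hder lim0 limη fun t ht =>
    div_nonneg (hpos _) (mul_nonneg (weight_pos ha k ht.1 ht.2).le
      (by linarith [le_A1 ha (k + 1) ht.1 ht.2]))
  rw [← integral_Ioc_eq_integral_Ioo, ← intervalIntegral.integral_of_le hη.le,
    intervalIntegral.integral_eq_sub_of_hasDerivAt_of_tendsto hη hder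
      ((intervalIntegrable_iff_integrableOn_Ioo_of_le hη.le).2 hint) lim0 limη]
  simp [hT]

/-- Extension by zero of a function on `(0, η)` that vanishes off `[α, β] ⊂ (0, η)`. -/
lemma continuous_indicator_Ioo {g : ℝ → ℝ} {α β : ℝ} (hα : 0 < α) (hβ : β < η)
    (hg : ContinuousOn g (Ioo 0 η)) (hsupp : ∀ t ∈ Ioo 0 η, t ∉ Icc α β → g t = 0) :
    Continuous ((Ioo 0 η).indicator g) := by
  refine continuous_iff_continuousAt.2 fun t => ?_
  by_cases ht : t ∈ Icc α β
  · have hmem : Ioo 0 η ∈ 𝓝 t := Ioo_mem_nhds (hα.trans_le ht.1) (ht.2.trans_lt hβ)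
    refine (hg.continuousAt hmem).congr ?_
    filter_upwards [hmem] with s hs
    rw [indicator_of_mem hs]
  · refine (continuousAt_const (y := (0 : ℝ))).congr ?_
    filter_upwards [isClosed_Icc.isOpen_compl.mem_nhds ht] with s hs
    by_cases hs' : s ∈ Ioo 0 η
    · rw [indicator_of_mem hs', hsupp s hs' hs]
    · rw [indicator_of_notMem hs']

/-- The `C¹` functions `A1_{k+1}^(1/q) * χ(δ log A1_{k+1})`, with a fixed bump `χ` and small `δ`:
the power `A1_{k+1}^(1/q)` is the formal extremal of the Hardy inequality, and stretching the
logarithmic cut-off makes the energy of `χ` negligible. -/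
lemma exists_C1_almost_extremal (ha : 1 < a) (hη : 0 < η) (k : ℕ) {p q K : ℝ}
    (hpq : p.HolderConjugate q) (hK : (1 / q) ^ p < K) :
    ∃ (f f' : ℝ → ℝ) (α β : ℝ), 0 < α ∧ β < η ∧ (∀ t ∉ Icc α β, f t = 0) ∧
      (∀ t, HasDerivAt f (f' t) t) ∧ Continuous f' ∧
      ∫ t in Ioo 0 η, |f' t| ^ p * weight a k 1 η t ^ (p - 1) <
        K * ∫ t in Ioo 0 η, |f t| ^ p * (1 / (weight a k 1 η t * A1 a (k + 1) (η / t) ^ p)) := by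
  have hp := hpq.lt
  have hp0 := hpq.pos
  have hq0 := hpq.symm.pos
  let χ : ContDiffBump (2 : ℝ) := ⟨1 / 2, 1, by norm_num, by norm_num⟩
  have hχc : Continuous χ := χ.continuous
  have hχd : ∀ s, HasDerivAt χ (deriv χ s) s := fun s =>
    ((χ.contDiff (n := 1)).differentiable (by simp) s).hasDerivAt
  have hχ'c : Continuous (deriv χ) := (χ.contDiff (n := 1)).continuous_deriv (by simp)
  have hχ0 : ∀ s ∉ Ioo (1 : ℝ) 3, χ s = 0 := by
    intro s hs
    refine χ.zero_of_le_dist ?_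
    by_contra hlt
    rw [not_le, Real.dist_eq, abs_lt] at hlt
    have h1 : -(1 : ℝ) < s - 2 := hlt.1
    have h2 : s - 2 < (1 : ℝ) := hlt.2
    exact hs ⟨by linarith, by linarith⟩
  have hχ'0 : ∀ s ∉ Icc (1 : ℝ) 3, deriv χ s = 0 := by
    intro s hs
    have : χ =ᶠ[𝓝 s] fun _ => (0 : ℝ) := by
      filter_upwards [isClosed_Icc.isOpen_compl.mem_nhds hs] with r hr
      exact hχ0 r fun hm => hr (Ioo_subset_Icc_self hm)
    rw [this.deriv_eq, deriv_const]
  have hχp : Continuous fun s => |χ s| ^ p := hχc.abs.rpow_const fun _ => Or.inr hp0.le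
  have hI : 0 < ∫ s in (1 : ℝ)..3, |χ s| ^ p := by
    refine intervalIntegral.intervalIntegral_pos_of_pos_on (hχp.intervalIntegrable _ _)
      (fun s hs => ?_) (by norm_num)
    have : 0 < χ s := χ.pos_of_mem_ball (by
      rw [Metric.mem_ball, Real.dist_eq, abs_lt]
      exact ⟨(by linarith [hs.1] : -(1 : ℝ) < s - 2), (by linarith [hs.2] : s - 2 < (1 : ℝ))⟩)
    positivity
  -- The energy of the stretched profile depends continuously on `δ`.
  have hJc : Continuous fun δ : ℝ => ∫ s in (1 : ℝ)..3, |1 / q * χ s + δ * deriv χ s| ^ p := by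
    refine intervalIntegral.continuous_parametric_intervalIntegral_of_continuous'
      (f := fun δ s => |1 / q * χ s + δ * deriv χ s| ^ p) ?_ 1 3
    refine Continuous.rpow_const ?_ fun _ => Or.inr hp0.le
    fun_prop
  have hJ0 : ∫ s in (1 : ℝ)..3, |1 / q * χ s + 0 * deriv χ s| ^ p <
      K * ∫ s in (1 : ℝ)..3, |χ s| ^ p := by
    have : ∀ s, |1 / q * χ s + 0 * deriv χ s| ^ p = (1 / q) ^ p * |χ s| ^ p := by
      intro s
      rw [zero_mul, add_zero, abs_mul, Real.mul_rpow (abs_nonneg _) (abs_nonneg _),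
        abs_of_nonneg (by positivity : 0 ≤ 1 / q)]
    simp only [this, intervalIntegral.integral_const_mul]
    exact mul_lt_mul_of_pos_right hK hI
  obtain ⟨δ, ⟨hδJ, hδa⟩, hδ⟩ : ∃ δ : ℝ, ((∫ s in (1 : ℝ)..3, |1 / q * χ s + δ * deriv χ s| ^ p) <
      K * (∫ s in (1 : ℝ)..3, |χ s| ^ p) ∧ δ * Real.log a < 1) ∧ 0 < δ := by
    have e1 := hJc.continuousAt.eventually_lt_const hJ0
    have e2 : ∀ᶠ δ : ℝ in 𝓝 0, δ * Real.log a < 1 :=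
      (by fun_prop : Continuous fun δ : ℝ => δ * Real.log a).continuousAt.eventually_lt_const
        (by simp)
    exact (((e1.and e2).filter_mono nhdsWithin_le_nhds).and
      (eventually_mem_nhdsWithin (s := Ioi (0 : ℝ)))).exists
  set S : ℝ → ℝ := fun t => δ * Real.log (A1 a (k + 1) (η / t)) with hS
  obtain ⟨α, hα, hαS⟩ : ∃ α, 0 < α ∧ ∀ t, 0 < t → t < α → 3 < S t := by
    have h1 := (Real.tendsto_log_atTop.comp (tendsto_A1_zero ha hη (k + 1))).const_mul_atTop hδ
    obtain ⟨α, hα, h⟩ := mem_nhdsGT_iff_exists_Ioo_subset.1 (h1.eventually_gt_atTop 3)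
    exact ⟨α, hα, fun t h0 h2 => h ⟨h0, h2⟩⟩
  obtain ⟨β, hβ, hβS⟩ : ∃ β, β < η ∧ ∀ t, β < t → t < η → S t < 1 := by
    have h1 := ((tendsto_A1_radius ha hη (k + 1)).log (by linarith)).const_mul δ
    obtain ⟨β, hβ, h⟩ := mem_nhdsLT_iff_exists_Ioo_subset.1 (h1.eventually_lt_const hδa)
    exact ⟨β, hβ, fun t h0 h2 => h ⟨h0, h2⟩⟩
  have hSout : ∀ t ∈ Ioo 0 η, t ∉ Icc α β → S t ∉ Icc (1 : ℝ) 3 := by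
    intro t ht hn hm
    rcases lt_or_ge t α with h | h
    · exact absurd hm.2 (not_le.2 (hαS t ht.1 h))
    · have h2 : β < t := not_le.1 fun h2 => hn ⟨h, h2⟩
      exact absurd hm.1 (not_le.2 (hβS t h2 ht.2))
  set f₀ : ℝ → ℝ := fun t => A1 a (k + 1) (η / t) ^ (1 / q) * χ (S t) with hf₀
  set f₁ : ℝ → ℝ := fun t => -(A1 a (k + 1) (η / t) ^ (1 / q - 1) / weight a k 1 η t *
    (1 / q * χ (S t) + δ * deriv χ (S t))) with hf₁
  have hf₀0 : ∀ t ∈ Ioo 0 η, t ∉ Icc α β → f₀ t = 0 := by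
    intro t ht hn
    rw [hf₀]
    simp only
    rw [hχ0 _ fun hm => hSout t ht hn (Ioo_subset_Icc_self hm), mul_zero]
  have hf₁0 : ∀ t ∈ Ioo 0 η, t ∉ Icc α β → f₁ t = 0 := by
    intro t ht hn
    rw [hf₁]
    simp only
    rw [hχ0 _ fun hm => hSout t ht hn (Ioo_subset_Icc_self hm), hχ'0 _ (hSout t ht hn)]
    ring
  have hGpos : ∀ t ∈ Ioo 0 η, 0 < A1 a (k + 1) (η / t) := fun t ht => by
    linarith [le_A1 ha (k + 1) ht.1 ht.2]
  have hSd : ∀ t ∈ Ioo 0 η, HasDerivAt S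
      (δ * (-(1 / weight a k 1 η t) / A1 a (k + 1) (η / t))) t := fun t ht =>
    ((hasDerivAt_A1 ha k ht.1 ht.2).log (hGpos t ht).ne').const_mul δ
  have hSc : ContinuousOn S (Ioo 0 η) := fun t ht => (hSd t ht).continuousAt.continuousWithinAt
  have hf₀d : ∀ t ∈ Ioo 0 η, HasDerivAt f₀ (f₁ t) t := by
    intro t ht
    have hG0 := hGpos t ht
    have hw := weight_pos ha k ht.1 ht.2
    refine (((hasDerivAt_A1 ha k ht.1 ht.2).rpow_const (p := 1 / q) (Or.inl hG0.ne')).mul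
      ((hχd (S t)).comp t (hSd t ht))).congr_deriv ?_
    have e : A1 a (k + 1) (η / t) ^ (1 / q) =
        A1 a (k + 1) (η / t) ^ (1 / q - 1) * A1 a (k + 1) (η / t) := by
      rw [← Real.rpow_add_one hG0.ne', sub_add_cancel]
    simp only [hf₁, Function.comp, e]
    field_simp
    ring
  have hf₁c : ContinuousOn f₁ (Ioo 0 η) := by
    refine ((((continuousOn_A1 ha (k + 1)).rpow_const fun t ht => Or.inl (hGpos t ht).ne').div
      (continuousOn_weight ha k) fun t ht => (weight_pos ha k ht.1 ht.2).ne').mul ?_).neg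
    exact (continuousOn_const.mul (hχc.comp_continuousOn hSc)).add
      (continuousOn_const.mul (hχ'c.comp_continuousOn hSc))
  refine ⟨(Ioo 0 η).indicator f₀, (Ioo 0 η).indicator f₁, α, β, hα, hβ, fun t ht => ?_,
    fun t => ?_, continuous_indicator_Ioo hα hβ hf₁c hf₁0, ?_⟩
  · by_cases ht' : t ∈ Ioo 0 η
    · rw [indicator_of_mem ht', hf₀0 t ht' ht]
    · rw [indicator_of_notMem ht']
  · by_cases ht : t ∈ Icc α β
    · have hm : t ∈ Ioo 0 η := ⟨hα.trans_le ht.1, ht.2.trans_lt hβ⟩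
      rw [indicator_of_mem hm]
      refine (hf₀d t hm).congr_of_eventuallyEq ?_
      filter_upwards [isOpen_Ioo.mem_nhds hm] with s hs
      rw [indicator_of_mem hs]
    · have h1 : (Ioo 0 η).indicator f₁ t = 0 := by
        by_cases ht' : t ∈ Ioo 0 η
        · rw [indicator_of_mem ht', hf₁0 t ht' ht]
        · rw [indicator_of_notMem ht']
      rw [h1]
      refine (hasDerivAt_const t (0 : ℝ)).congr_of_eventuallyEq ?_
      filter_upwards [isClosed_Icc.isOpen_compl.mem_nhds ht] with s hs
      by_cases hs' : s ∈ Ioo 0 η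
      · rw [indicator_of_mem hs', hf₀0 s hs' hs]
      · rw [indicator_of_notMem hs']
  -- In the variable `s = δ log A1_{k+1}` both sides become integrals of the profile.
  have hE : ∫ t in Ioo 0 η, |(Ioo 0 η).indicator f₁ t| ^ p * weight a k 1 η t ^ (p - 1) =
      δ⁻¹ * ∫ s in (1 : ℝ)..3, |1 / q * χ s + δ * deriv χ s| ^ p := by
    rw [← setIntegral_comp_log_A1 ha hη k (Θ := fun s => |1 / q * χ s + δ * deriv χ s| ^ p)
      (Continuous.rpow_const (by fun_prop) fun _ => Or.inr hp0.le)
      (fun s => by positivity) (fun s hs => ?_) hδ hδa]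
    · refine setIntegral_congr_fun measurableSet_Ioo fun t ht => ?_
      have hG0 := hGpos t ht
      have hw := weight_pos ha k ht.1 ht.2
      simp only [indicator_of_mem ht, hf₁]
      have e1 : (1 / q - 1) * p = -1 := by
        have := hpq.inv_add_inv_eq_one
        have h2 : 1 / q - 1 = -p⁻¹ := by rw [one_div]; linarith
        rw [h2, neg_mul, inv_mul_cancel₀ hp0.ne']
      have e2 : weight a k 1 η t ^ p = weight a k 1 η t ^ (p - 1) * weight a k 1 η t := by
        rw [← Real.rpow_add_one hw.ne', sub_add_cancel]
      rw [abs_neg, abs_mul, abs_of_nonneg (by positivity : 0 ≤ A1 a (k + 1) (η / t) ^ (1 / q - 1) /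
        weight a k 1 η t), Real.mul_rpow (by positivity) (abs_nonneg _),
        Real.div_rpow (by positivity) hw.le, ← Real.rpow_mul hG0.le, e1, e2, Real.rpow_neg_one]
      have := Real.rpow_pos_of_pos hw (p - 1)
      field_simp
      rfl
    · rw [hχ0 _ fun hm => hs (Ioo_subset_Icc_self hm), hχ'0 _ hs]
      simp [Real.zero_rpow hp0.ne']
  have hH : ∫ t in Ioo 0 η, |(Ioo 0 η).indicator f₀ t| ^ p *
      (1 / (weight a k 1 η t * A1 a (k + 1) (η / t) ^ p)) =
      δ⁻¹ * ∫ s in (1 : ℝ)..3, |χ s| ^ p := by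
    rw [← setIntegral_comp_log_A1 ha hη k (Θ := fun s => |χ s| ^ p) hχp
      (fun s => by positivity) (fun s hs => ?_) hδ hδa]
    · refine setIntegral_congr_fun measurableSet_Ioo fun t ht => ?_
      have hG0 := hGpos t ht
      have hw := weight_pos ha k ht.1 ht.2
      simp only [indicator_of_mem ht, hf₀]
      have e1 : 1 / q * p = p - 1 := by
        rw [one_div_mul_eq_div]; exact hpq.div_conj_eq_sub_one
      have e2 : A1 a (k + 1) (η / t) ^ p =
          A1 a (k + 1) (η / t) ^ (p - 1) * A1 a (k + 1) (η / t) := by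
        rw [← Real.rpow_add_one hG0.ne', sub_add_cancel]
      rw [abs_mul, abs_of_nonneg (by positivity : 0 ≤ A1 a (k + 1) (η / t) ^ (1 / q)),
        Real.mul_rpow (by positivity) (abs_nonneg _), ← Real.rpow_mul hG0.le, e1, e2]
      have := Real.rpow_pos_of_pos hG0 (p - 1)
      field_simp
      rfl
    · rw [hχ0 _ fun hm => hs (Ioo_subset_Icc_self hm)]
      simp [Real.zero_rpow hp0.ne']
  rw [hE, hH, mul_left_comm]
  exact mul_lt_mul_of_pos_left hδJ (inv_pos.2 hδ)

/-- Uniform convergence carries over to the weighted `L^p` integrals. -/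
lemma tendsto_setIntegral_abs_rpow_mul {ρ : ℝ → ℝ} {s : Set ℝ} (hρ : IntegrableOn ρ s)
    {p : ℝ} (hp : 0 < p) {g : ℝ → ℝ} {h : ℕ → ℝ → ℝ} {B : ℝ} (hB : ∀ t, |g t| ≤ B)
    (hh : ∀ m, Continuous (h m)) (hconv : ∀ m t, |h m t - g t| ≤ 1 / ((m : ℝ) + 1)) :
    Tendsto (fun m => ∫ t in s, |h m t| ^ p * ρ t) atTop (𝓝 (∫ t in s, |g t| ^ p * ρ t)) := by
  refine tendsto_integral_of_dominated_convergence (fun t => (B + 1) ^ p * |ρ t|)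
    (fun m => ?_) (hρ.abs.const_mul _) (fun m => Eventually.of_forall fun t => ?_)
    (Eventually.of_forall fun t => ?_)
  · exact ((hh m).abs.rpow_const fun _ => Or.inr hp.le).aestronglyMeasurable.mul
      hρ.aestronglyMeasurable
  · rw [norm_mul, Real.norm_of_nonneg (Real.rpow_nonneg (abs_nonneg _) _), Real.norm_eq_abs]
    refine mul_le_mul_of_nonneg_right (Real.rpow_le_rpow (abs_nonneg _) ?_ hp.le) (abs_nonneg _)
    have h1 : 1 / ((m : ℝ) + 1) ≤ 1 := by
      rw [div_le_one (by positivity)]; linarith [(Nat.cast_nonneg m : (0 : ℝ) ≤ m)]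
    have h2 := abs_add_le (h m t - g t) (g t)
    rw [sub_add_cancel] at h2
    linarith [hconv m t, hB t]
  · have h1 : Tendsto (fun m => h m t) atTop (𝓝 (g t)) := by
      rw [tendsto_iff_norm_sub_tendsto_zero]
      exact squeeze_zero (fun _ => norm_nonneg _) (fun m => hconv m t)
        tendsto_one_div_add_atTop_nhds_zero_nat
    exact ((h1.abs).rpow_const (Or.inr hp.le)).mul_const _

lemma exists_smooth_almost_extremal (ha : 1 < a) (hη : 0 < η) (k : ℕ) {p q K : ℝ}
    (hpq : p.HolderConjugate q) (hK : (1 / q) ^ p < K) :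
    ∃ (h : ℝ → ℝ) (α β : ℝ), 0 < α ∧ β < η ∧ ContDiff ℝ ∞ h ∧ (∀ t ∉ Icc α β, h t = 0) ∧
      ∫ t in Ioo 0 η, |deriv h t| ^ p * weight a k 1 η t ^ (p - 1) <
        K * ∫ t in Ioo 0 η, |h t| ^ p * (1 / (weight a k 1 η t * A1 a (k + 1) (η / t) ^ p)) := by
  obtain ⟨f, f', α, β, hα, hβ, hsupp, hf, hf', hlt⟩ := exists_C1_almost_extremal ha hη k hpq hK
  have hfc : Continuous f := continuous_iff_continuousAt.2 fun t => (hf t).continuousAt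
  have hcs : HasCompactSupport f := HasCompactSupport.intro isCompact_Icc fun t ht => hsupp t ht
  have hcs' : HasCompactSupport f' := by
    have : deriv f = f' := funext fun t => (hf t).deriv
    exact this ▸ hcs.deriv
  obtain ⟨B, hB⟩ := hcs.exists_bound_of_continuous hfc
  obtain ⟨B', hB'⟩ := hcs'.exists_bound_of_continuous hf'
  set δ := min (α / 2) ((η - β) / 2) with hδ
  have hδ0 : 0 < δ := lt_min (by linarith) (by linarith)
  have hδ1 : δ ≤ α / 2 := min_le_left _ _
  have hδ2 : δ ≤ (η - β) / 2 := min_le_right _ _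
  choose h hh1 hh2 hh3 hh4 using fun m : ℕ =>
    exists_contDiff_approx hf hf' hsupp hδ0 (ε := 1 / ((m : ℝ) + 1)) (by positivity)
  have t1 := tendsto_setIntegral_abs_rpow_mul
    (integrableOn_weight_rpow ha hη k (sub_nonneg.2 hpq.lt.le)) hpq.pos hB'
    (fun m => (hh1 m).continuous_deriv (by simp)) hh4
  have t2 := (tendsto_setIntegral_abs_rpow_mul (integrableOn_one_div_hardyWeight ha hη k hpq.lt)
    hpq.pos hB (fun m => (hh1 m).continuous) hh3).const_mul K
  obtain ⟨m, hm⟩ := (t1.eventually_lt t2 hlt).exists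
  exact ⟨h m, α - δ, β + δ, by linarith, by linarith, hh1 m, hh2 m, hm⟩

end Sharp

end SuperLog

theorem proposition5p1 (a : ℝ) (ha : 1 < a) (k : ℕ) (η : ℝ) (hη : 0 < η)
    (p : ℝ) (hp : 1 < p) :
    (∃ C : ℝ, 0 < C ∧ ∀ n : ℕ, 1 ≤ n →
      ∀ u : EuclideanSpace ℝ (Fin n) → ℝ, SuperLog.IsTestFunction η u →
        IntegrableOn (SuperLog.energyDensity a k η p u) (Metric.ball 0 η) ∧
        IntegrableOn (SuperLog.hardyDensity a k η p u) (Metric.ball 0 η) ∧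
        IntegrableOn (SuperLog.remainderDensity a k η p u) (Metric.ball 0 η) ∧
        (1 / p.conjExponent) ^ p *
              (∫ x in Metric.ball 0 η, SuperLog.hardyDensity a k η p u x) +
            C * (∫ x in Metric.ball 0 η, SuperLog.remainderDensity a k η p u x) ≤
          ∫ x in Metric.ball 0 η, SuperLog.energyDensity a k η p u x) ∧
    (∀ n : ℕ, 1 ≤ n → ∀ K : ℝ, (1 / p.conjExponent) ^ p < K →
      ∃ u : EuclideanSpace ℝ (Fin n) → ℝ, SuperLog.IsTestFunction η u ∧
        (∫ x in Metric.ball 0 η, SuperLog.energyDensity a k η p u x) <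
          K * ∫ x in Metric.ball 0 η, SuperLog.hardyDensity a k η p u x) := by
  have hpq := Real.HolderConjugate.conjExponent hp
  set q := p.conjExponent
  have hp0 := hpq.pos
  have hq0 := hpq.symm.pos
  have hq1 := hpq.symm.lt
  -- Any `c` with `0 < c < 1/p` and `q * c ≤ 1` works.
  set c := 1 / (2 * p * q) with hc
  have hc0 : 0 < c := by positivity
  have hqc : q * c ≤ 1 := by
    have : q * c = 1 / (2 * p) := by rw [hc]; field_simp
    rw [this, div_le_one (by positivity)]
    linarith
  have hC : 0 < c - p * c ^ 2 := by
    have h1 : p * c = 1 / (2 * q) := by rw [hc]; field_simp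
    have h2 : p * c < 1 := by
      rw [h1, div_lt_one (by positivity)]
      linarith
    nlinarith
  refine ⟨⟨(1 / q) ^ (p - 1) * (c - p * c ^ 2), by positivity, fun n hn u hu =>
    ⟨SuperLog.integrableOn_energyDensity ha hη k hp hn hu,
      SuperLog.integrableOn_hardyDensity ha hη k hp hn hu,
      SuperLog.integrableOn_remainderDensity ha hη k hp hn hu,
      SuperLog.ball_hardy ha hη k hpq hc0.le hqc hn hu⟩⟩, fun n hn K hK => ?_⟩
  obtain ⟨h, α, β, hα, hβ, hh, hsupp, hlt⟩ :=
    SuperLog.exists_smooth_almost_extremal ha hη k hpq hK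
  refine ⟨fun x => h ‖x‖, SuperLog.isTestFunction_radial hα hβ hh hsupp, ?_⟩
  rw [SuperLog.setIntegral_energyDensity_radial hn k hα hh hsupp,
    SuperLog.setIntegral_hardyDensity_radial hn k, mul_left_comm]
  have hvol : 0 < volume.real (Metric.ball (0 : EuclideanSpace ℝ (Fin n)) 1) :=
    ENNReal.toReal_pos (Metric.measure_ball_pos _ _ one_pos).ne' measure_ball_lt_top.ne
  have hn0 : (0 : ℝ) < n := by exact_mod_cast hn
  exact mul_lt_mul_of_pos_left hlt (mul_pos hn0 hvol)
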